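/- Let $d$ be a positive integer and let $\mathscr T_1,\dots,\mathscr T_d$ be locally finite, leafless, rooted directed trees, $\mathscr T_j=(V_j,\mathcal E_j)$ with root $\mathsf{root}_j$, each having finite branching index (the depths of the vertices of $\mathscr T_j$ with at least two children are bounded). Put $V=V_1\times\cdots\times V_d$ and $\mathsf{root}=(\mathsf{root}_1,\dots,\mathsf{root}_d)$. For $v\in V$ let $\mathsf d_v\in\mathbb N^d$ be the multiindex whose $j$-th entry $\mathsf d_{v_j}$ is the depth of $v_j$ in $\mathscr T_j$, let $|\mathsf d_v|$ be the sum of its entries, and let $\mathsf{Chi}_j(v)$ be the set of the vertices obtained from $v$ by replacing $v_j$ by one of its children. A weight system $(\lambda_j(w))$ (where $w_j\ne\mathsf{root}_j$) with $\sup_v\sum_{w\in\mathsf{Chi}_j(v)}\lambda_j(w)^2<\infty$ for every $j$ defines the bounded multishift $S=(S_1,\dots,S_d)$ on $l^2(V)$, $S_je_v=\sum_{w\in\mathsf{Chi}_j(v)}\lambda_j(w)e_w$. Let $a$ be a positive integer with $a<d$. Let $S_{\lambda_{\mathfrak c_a}}$ be the Drury–Arveson-type multishift, with weights $$\lambda_j(w)=\frac{1}{\sqrt{\operatorname{card}\mathsf{Chi}_j(v)}}\sqrt{\frac{\mathsf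 d_{v_j}+1}{|\mathsf d_v|+a}},\qquad w\in\mathsf{Chi}_j(v),$$ and let $S^{\mathfrak s}$ be its spherical Cauchy dual, the multishift with weights $\lambda^{\mathfrak s}_j(w)=\lambda_j(w)\big(\sum_{i=1}^d\|S_ie_v\|^2\big)^{-1}$, $w\in\mathsf{Chi}_j(v)$, where $S_1,\dots,S_d$ are the components of $S_{\lambda_{\mathfrak c_a}}$. Let $E=\bigcap_j\ker (S^{\mathfrak s}_j)^*$. The Cauchy dual module $\mathscr H^{\mathfrak s}_{\mathfrak c_a}(\mathscr T)$ (the analytic model of $S^{\mathfrak s}$) is the space of the $E$-valued functions $F(z)=\sum_{\alpha\in\mathbb N^d}f_\alpha z^\alpha$ on the unit ball $\mathbb B^d$ of $\mathbb C^d$ with $\sum_\alpha\|(S^{\mathfrak s})^\alpha f_\alpha\|^2<\infty$, with inner product $\langle F,G\rangle=\sum_\alpha\langle (S^{\mathfrak s})^\alpha f_\alpha,(S^{\mathfrak s})^\alpha g_\alpha\rangle$. For $F\subseteq\{1,\dots,d\}$ let $\Phi_F=\{v\in V: v_j\neq\mathsf{root}_j\text{ if and only if }j\in F\}$. For $u\in\Phi_F$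 let $\mathsf{sib}_F(u)$ be the set of the $v\in V$ such that $v_j$ has the same parent as $u_j$ for $j\in F$ and $v_j=u_j$ for $j\notin F$. Let $\Omega_F\subseteq\Phi_F$ contain exactly one element of each of the classes $\mathsf{sib}_F(u)$. For $u\in\Omega_F$ let $\mathcal L_{u,F}\subseteq E$ be the space of the $f\in l^2(\mathsf{sib}_F(u))$ such that, for all $j\in F$ and $v\in\mathsf{sib}_F(u)$, $\sum_{w}f(w)\lambda^{\mathfrak s}_j(w)=0$, where $w$ runs through the elements of $\mathsf{sib}_F(u)$ with $w_i=v_i$ for all $i\neq j$. For $l\in\mathbb N$ and $s\in[0,1]$ put $$\omega_l(s)=(l+a)\cdots(l+d-1)\sum_{i=a}^{d-1}\frac{s^{i+l-1}}{\prod_{a\le j\ne i\le d-1}(j-i)},$$ and for $u\in\Omega_F$ let $$d\rho_u(s)=\omega_{|\mathsf d_u|}(s)\,dm(s),\qquad d\nu_u(z)=\frac{|z^{\mathsf d_u}|^2}{\|z^{\mathsf d_u}\|^2_{L^2(\partial\mathbb B^d,\sigma)}}\,d\sigma(z),$$ where $m$ is the Lebesgue measure on $[0,1]$ and $\sigma$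 is the normalized surface area measure on $\partial\mathbb B^d$. Then $\omega_l\ge 0$ on $[0,1]$ for every $l\in\mathbb N$, and $\mathscr H^{\mathfrak s}_{\mathfrak c_a}(\mathscr T)$ admits the representing measure $(\rho_u\times\nu_u)_{u\in\Omega_F,\,F\subseteq\{1,\dots,d\}}$. That is, the measures $\rho_u$ and $\nu_u$ are finite, and there is a measure $\mu$ on $\mathbb R\times\partial\mathbb B^d$ whose values are positive operators in $B(E)$, supported on $[0,1]\times\partial\mathbb B^d$, such that (i) for all $f\in E$ and $\alpha\in\mathbb N^d$, the function $s^{|\alpha|}|z^\alpha|^2$ is integrable for $\langle d\mu f,f\rangle$ and $$\|z^\alpha f\|^2_{\mathscr H^{\mathfrak s}_{\mathfrak c_a}(\mathscr T)}=\int_{[0,1]\times\partial\mathbb B^d}s^{|\alpha|}|z^\alpha|^2\,\langle d\mu(s,z)f,f\rangle;$$ (ii) $\mu(A)\big(\sum_{F}\sum_{u\in\Omega_F}g_{u,F}\big)=\sum_{F}\sum_{u\in\Omega_F}(\rho_u\times\nu_u)(A)\,g_{u,F}$ for every Borel set $A$ and all $g_{u,F}\in\mathcal L_{u,F}$ for which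 the sum on the left converges; (iii) $\rho_{\mathsf{root}}$ and $\nu_{\mathsf{root}}$ are probability measures. -/

import Mathlib

open MeasureTheory

noncomputable section

/-! ### Rooted directed trees -/

/-- A rooted directed tree: `Adj u v` means that `(u, v)` is a directed edge. The root has no parent,
every other vertex has exactly one parent, and every vertex is reached from the root by a directed
path. (Equivalently: a connected directed graph without circuits in which every vertex has at most
one parent, and in which `root` is the vertex without a parent.) -/
structure RootedDirectedTree (V : Type*) extends Digraph V where
  root : V
  not_adj_root : ∀ u, ¬ Adj u root
  existsUnique_parent : ∀ v, v ≠ root → ∃! u, Adj u v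
  reachable : ∀ v, Relation.ReflTransGen Adj root v

namespace RootedDirectedTree

variable {V : Type*} (T : RootedDirectedTree V)

/-- `Chi(v)`. -/
def children (v : V) : Set V := {w | T.Adj v w}

open Classical in
/-- `par(v)`; it is only used for `v ≠ root` (and is set to be `root` at the root). -/
def parent (v : V) : V :=
  if h : v = T.root then T.root else (T.existsUnique_parent v h).choose

/-- `Chi^n(root)`: the vertices that can be reached from the root by a path with `n` edges. -/
def generation : ℕ → Set V
  | 0 => {T.root}
  | n + 1 => {w | ∃ v ∈ generation n, T.Adj v w}

theorem exists_mem_generation (v : V) : ∃ n, v ∈ T.generation n := by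
  induction T.reachable v with
  | refl => exact ⟨0, rfl⟩
  | tail _ h ih => exact ih.elim fun n hn => ⟨n + 1, _, hn, h⟩

open Classical in
/-- The depth of a vertex: the (unique) `n` with `v ∈ Chi^n(root)`. -/
def depth (v : V) : ℕ := Nat.find (T.exists_mem_generation v)

/-- Every vertex has at least one child. -/
def Leafless : Prop := ∀ v, (T.children v).Nonempty

/-- Every vertex has finitely many children. -/
def LocallyFinite : Prop := ∀ v, (T.children v).Finite

/-- The branching index: `1 + sup` of the depths of the vertices with at least two children, and `0`
if there is no such vertex. -/
def branchingIndex : ℕ∞ := ⨆ w ∈ {v : V | (T.children v).Nontrivial}, ((T.depth w : ℕ∞) + 1)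

end RootedDirectedTree

/-! ### The directed Cartesian product and its multishifts -/

/-- `l^2(X)`. -/
abbrev SqSum (X : Type*) := lp (fun _ : X => ℂ) 2

namespace TreeProduct

variable {d : ℕ} {V : Fin d → Type*} (T : ∀ j, RootedDirectedTree (V j))

/-- The root of the product. -/
def root : ∀ j, V j := fun j => (T j).root

/-- `par_j(v)`, for `v` with `v_j ≠ root_j`. -/
def par (j : Fin d) (v : ∀ i, V i) : ∀ i, V i := Function.update v j ((T j).parent (v j))

/-- `Chi_j(v)`. -/
def chi (j : Fin d) (v : ∀ i, V i) : Set (∀ i, V i) :=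
  {w | ∃ η ∈ (T j).children (v j), w = Function.update v j η}

/-- `sib_j(v) = Chi_j(par_j(v))`, for `v` with `v_j ≠ root_j`. -/
def sib (j : Fin d) (v : ∀ i, V i) : Set (∀ i, V i) := chi T j (par T j v)

/-- The depth `d_v`, a multiindex. -/
def depth (v : ∀ i, V i) : Fin d → ℕ := fun j => (T j).depth (v j)

/-- `|d_v|`. -/
def level (v : ∀ i, V i) : ℕ := ∑ j, depth T v j

/-- The product of the trees has finite joint branching index: `(k_{T_1}, …, k_{T_d})` lies
in `ℕ^d`. -/
def FiniteJointBranchingIndex : Prop := ∀ j, (T j).branchingIndex ≠ ⊤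

open Classical in
/-- The mapping `Λ^{(j)}` on complex functions on the set of vertices of the product. -/
def shiftFun (lam : Fin d → (∀ i, V i) → ℝ) (j : Fin d) (f : (∀ i, V i) → ℂ) (v : ∀ i, V i) : ℂ :=
  if v j = (T j).root then 0 else (lam j v : ℂ) * f (par T j v)

/-- `sup_v ∑_{w ∈ Chi_j(v)} λ_j(w)^2 ≤ C` (the sum is bounded through its finite partial sums). -/
def WeightBound (lam : Fin d → (∀ i, V i) → ℝ) (j : Fin d) (C : ℝ) : Prop :=
  0 ≤ C ∧ ∀ (v : ∀ i, V i) (s : Finset (∀ i, V i)), (s : Set (∀ i, V i)) ⊆ chi T j v →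
    ∑ w ∈ s, lam j w ^ 2 ≤ C

theorem mem_chi_par {j : Fin d} {v : ∀ i, V i} (h : v j ≠ (T j).root) : v ∈ chi T j (par T j v) := by
  refine ⟨v j, ?_, by simp [par]⟩
  simp only [par, Function.update_self, RootedDirectedTree.children, Set.mem_ofPred_eq,
    RootedDirectedTree.parent, h, dite_false]
  exact ((T j).existsUnique_parent (v j) h).choose_spec.1

theorem sum_shiftFun_le {lam : Fin d → (∀ i, V i) → ℝ} {j : Fin d} {C : ℝ}
    (h : WeightBound T lam j C) (f : SqSum (∀ i, V i)) (s : Finset (∀ i, V i)) :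
    ∑ v ∈ s, ‖shiftFun T lam j f v‖ ^ 2 ≤ C * ‖f‖ ^ 2 := by
  classical
  set s' := s.filter fun v => v j ≠ (T j).root with hs'
  have h1 : ∑ v ∈ s, ‖shiftFun T lam j f v‖ ^ 2
      = ∑ v ∈ s', lam j v ^ 2 * ‖f (par T j v)‖ ^ 2 := by
    rw [hs', Finset.sum_filter]
    refine Finset.sum_congr rfl fun v _ => ?_
    by_cases hv : v j = (T j).root <;> simp [shiftFun, hv, mul_pow]
  have h2 : ∑ v ∈ s', lam j v ^ 2 * ‖f (par T j v)‖ ^ 2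
      = ∑ u ∈ s'.image (par T j), (∑ v ∈ s' with par T j v = u, lam j v ^ 2) * ‖f u‖ ^ 2 := by
    rw [← Finset.sum_fiberwise_of_maps_to (fun v hv => Finset.mem_image_of_mem (par T j) hv)]
    refine Finset.sum_congr rfl fun u _ => ?_
    rw [Finset.sum_mul]
    refine Finset.sum_congr rfl fun v hv => ?_
    rw [(Finset.mem_filter.1 hv).2]
  have h3 : ∀ u, ∑ v ∈ s' with par T j v = u, lam j v ^ 2 ≤ C := fun u => by
    refine h.2 u _ fun v hv => ?_
    simp only [hs', Finset.coe_filter, Finset.mem_filter, Set.mem_ofPred_eq] at hv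
    rw [← hv.2]
    exact mem_chi_par T hv.1.2
  rw [h1, h2]
  calc _ ≤ ∑ u ∈ s'.image (par T j), C * ‖f u‖ ^ 2 :=
        Finset.sum_le_sum fun u _ => mul_le_mul_of_nonneg_right (h3 u) (by positivity)
    _ = C * ∑ u ∈ s'.image (par T j), ‖f u‖ ^ 2 := by rw [Finset.mul_sum]
    _ ≤ C * ‖f‖ ^ 2 := by
        refine mul_le_mul_of_nonneg_left ?_ h.1
        have := lp.sum_rpow_le_norm_rpow (p := 2) (by norm_num) f (s'.image (par T j))
        simpa using this

theorem shiftFun_memlp {lam : Fin d → (∀ i, V i) → ℝ} {j : Fin d} {C : ℝ}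
    (h : WeightBound T lam j C) (f : SqSum (∀ i, V i)) :
    Memℓp (shiftFun T lam j f) 2 := by
  refine memℓp_gen' (C := C * ‖f‖ ^ 2) fun s => ?_
  simpa using sum_shiftFun_le T h f s

/-- The bounded operator `S_j f = Λ^{(j)} f`. -/
def boundedShift {lam : Fin d → (∀ i, V i) → ℝ} {j : Fin d} {C : ℝ}
    (h : WeightBound T lam j C) : SqSum (∀ i, V i) →L[ℂ] SqSum (∀ i, V i) :=
  LinearMap.mkContinuous
    { toFun := fun f => (⟨shiftFun T lam j f, shiftFun_memlp T h f⟩ : SqSum (∀ i, V i))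
      map_add' := fun f g => by
        ext v
        change shiftFun T lam j (f + g : SqSum _) v = shiftFun T lam j f v + shiftFun T lam j g v
        by_cases hv : v j = (T j).root <;> simp [shiftFun, hv, mul_add]
      map_smul' := fun c f => by
        ext v
        by_cases hv : v j = (T j).root <;> simp [shiftFun, hv, mul_left_comm] }
    (Real.sqrt C) fun f => by
      refine lp.norm_le_of_forall_sum_le (p := 2) (by norm_num) (by positivity) fun s => ?_
      have := sum_shiftFun_le T h f s
      simpa [mul_pow, Real.sq_sqrt h.1] using this

open Classical in
/-- The multishift `(S_1, …, S_d)` with weights `lam` on the product of the trees. The operator `S_j`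
is bounded if and only if `sup_v ∑_{w ∈ Chi_j(v)} λ_j(w)^2 < ∞`; only bounded ones are considered
(and otherwise the value is irrelevant). -/
def multishift (lam : Fin d → (∀ i, V i) → ℝ) (j : Fin d) :
    SqSum (∀ i, V i) →L[ℂ] SqSum (∀ i, V i) :=
  if h : ∃ C, WeightBound T lam j C then boundedShift T h.choose_spec else 0

open Classical in
/-- The weights of the spherical Cauchy dual of the multishift with weights `lam`:
`λ_j(w) (∑_i ‖S_i e_v‖^2)⁻¹` for `w ∈ Chi_j(v)`. -/
def cauchyDualWeight (lam : Fin d → (∀ i, V i) → ℝ) (j : Fin d) (w : ∀ i, V i) : ℝ :=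
  lam j w * (∑ i, ‖multishift T lam i (lp.single 2 (par T j w) (1 : ℂ))‖ ^ 2)⁻¹

/-- The weight system `λ_c` of a sequence `c`: for `w ∈ Chi_j(v)`,
`λ_j(w) = √(c(|d_v|) / card Chi_j(v)) √((d_{v_j} + 1) / (|d_v| + d))`. -/
def balancedWeight (c : ℕ → ℝ) (j : Fin d) (w : ∀ i, V i) : ℝ :=
  Real.sqrt (c (level T (par T j w)) / ((chi T j (par T j w)).ncard : ℝ)) *
    Real.sqrt (((depth T (par T j w) j : ℝ) + 1) / ((level T (par T j w) : ℝ) + d))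

/-- The weights of the Drury-Arveson-type multishift: `λ_c` with `c(t) = (t + d) / (t + a)`. -/
def druryArvesonWeight (a : ℕ) : Fin d → (∀ i, V i) → ℝ :=
  balancedWeight T fun t => ((t : ℝ) + d) / ((t : ℝ) + a)

/-! ### The decomposition of the joint cokernel -/

/-- `Φ_F`. -/
def phi (F : Finset (Fin d)) : Set (∀ i, V i) :=
  {v | (∀ j ∈ F, v j ≠ (T j).root) ∧ ∀ j ∉ F, v j = (T j).root}

/-- `sib_F(u)`, for `u ∈ Φ_F`: all coordinates in `F` are replaced by siblings. -/
def sibF (F : Finset (Fin d)) (u : ∀ i, V i) : Set (∀ i, V i) :=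
  {v | (∀ j ∈ F, v j ∈ (T j).children ((T j).parent (u j))) ∧ ∀ j ∉ F, v j = u j}

/-- `Ω_F ⊆ Φ_F` contains exactly one element of each class `sib_F(u)`, `u ∈ Φ_F`. -/
def IsIndexingSet (F : Finset (Fin d)) (Om : Set (∀ i, V i)) : Prop :=
  Om ⊆ phi T F ∧ ∀ v ∈ phi T F, ∃! u, u ∈ Om ∧ u ∈ sibF T F v

open Classical in
/-- `v_G`: the coordinates outside `G` are replaced by roots. -/
def proj (G : Finset (Fin d)) (v : ∀ i, V i) : ∀ i, V i :=
  fun j => if j ∈ G then v j else (T j).root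

/-- The space `L_{u,F} ⊆ l^2(sib_F(u))` of the solutions of
`∑_{w ∈ sib_j(v_G | u_j)} f(w) λ_j(w) = 0`, where `j ∈ F`, `G = F \ {j}` and `v_G` runs through
`{v_G : v ∈ sib_F(u)}`; here `v_G | u_j` is `v_G` with `u_j` put in the place `j`. The sums are finite
for locally finite trees. -/
def solutionSpace (lam : Fin d → (∀ i, V i) → ℝ) (F : Finset (Fin d)) (u : ∀ i, V i) :
    Set (SqSum (∀ i, V i)) :=
  {f | (∀ w, w ∉ sibF T F u → f w = 0) ∧
    ∀ j ∈ F, ∀ v ∈ sibF T F u,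
      ∑ᶠ w ∈ sib T j (Function.update (proj T (F.erase j) v) j (u j)), f w * (lam j w : ℂ) = 0}

end TreeProduct

/-! ### The analytic model of a tuple of operators -/

/-- The monomial `z^α`. -/
def zpowMulti {d : ℕ} (z : EuclideanSpace ℂ (Fin d)) (α : Fin d → ℕ) : ℂ := ∏ i, z i ^ α i

/-- The open unit ball of `ℂ^d`. -/
abbrev CBall (d : ℕ) := Metric.ball (0 : EuclideanSpace ℂ (Fin d)) 1

/-- The unit sphere of `ℂ^d`. -/
abbrev CSphere (d : ℕ) := Metric.sphere (0 : EuclideanSpace ℂ (Fin d)) 1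

/-- A power series in `d` variables which converges to zero on the unit ball has zero
coefficients. -/
theorem scalar_coeff_eq_zero {d : ℕ} (c : (Fin d → ℕ) → ℂ)
    (h : ∀ z : CBall d, HasSum (fun α => zpowMulti z.1 α * c α) 0) : c = 0 := by
  classical
  -- the homogeneous parts vanish on the ball
  have key : ∀ (n : ℕ) (z : CBall d),
      ∑ α ∈ Finset.piAntidiag Finset.univ n, zpowMulti z.1 α * c α = 0 := by
    intro n z
    set p : ℕ → ℂ := fun n => ∑ α ∈ Finset.piAntidiag Finset.univ n, zpowMulti z.1 α * c α with hp
    have hsum : ∀ t : ℂ, ‖t‖ ≤ 1 → HasSum (fun n => t ^ n * p n) 0 := by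
      intro t ht
      have hmem : t • z.1 ∈ Metric.ball (0 : EuclideanSpace ℂ (Fin d)) 1 := by
        have hz := mem_ball_zero_iff.1 z.2
        rw [mem_ball_zero_iff, norm_smul]
        calc ‖t‖ * ‖z.1‖ ≤ 1 * ‖z.1‖ := by gcongr
          _ < 1 := by simpa using hz
      have h0 := h ⟨t • z.1, hmem⟩
      have h1 := (Equiv.sigmaFiberEquiv fun α : Fin d → ℕ => ∑ i, α i).hasSum_iff.2 h0
      have hg : ∀ m : ℕ, HasSum (fun x : {α : Fin d → ℕ // ∑ i, α i = m} =>
          zpowMulti (t • z.1) x.1 * c x.1) (t ^ m * p m) := by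
        intro m
        have hset : {α : Fin d → ℕ | ∑ i, α i = m}
            = ((Finset.piAntidiag Finset.univ m : Finset (Fin d → ℕ)) : Set (Fin d → ℕ)) := by
          ext α; simp
        have e : t ^ m * p m = ∑ α ∈ Finset.piAntidiag Finset.univ m,
            zpowMulti (t • z.1) α * c α := by
          rw [hp, Finset.mul_sum]
          refine Finset.sum_congr rfl fun α hα => ?_
          have hα' : ∑ i, α i = m := by simpa using hα
          simp only [zpowMulti, PiLp.smul_apply, smul_eq_mul, mul_pow, Finset.prod_mul_distrib,
            Finset.prod_pow_eq_pow_sum, hα']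
          ring
        rw [e]
        have := Finset.hasSum (Finset.piAntidiag Finset.univ m)
          (fun α : Fin d → ℕ => zpowMulti (t • z.1) α * c α)
        exact (Equiv.hasSum_iff (Equiv.setCongr hset)).2 this
      exact HasSum.sigma h1 hg
    set q : FormalMultilinearSeries ℂ ℂ ℂ :=
      fun n => ContinuousMultilinearMap.mkPiRing ℂ (Fin n) (p n) with hq
    have hrad : (1 : ENNReal) ≤ q.radius := by
      have : Summable fun n => ‖q n‖ * ((1 : NNReal) : ℝ) ^ n := by
        have := (hsum 1 (by simp)).summable.norm
        simpa [hq] using this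
      simpa using q.le_radius_of_summable_norm this
    have hfp : HasFPowerSeriesOnBall (0 : ℂ → ℂ) q 0 1 := by
      refine ⟨hrad, by simp, fun {y} hy => ?_⟩
      have hy' : ‖y‖ ≤ 1 := by
        have h1 : ‖y‖ₑ < 1 := by simpa using hy
        rw [← ofReal_norm, ENNReal.ofReal_lt_one] at h1
        exact h1.le
      simpa [hq] using hsum y hy'
    have := congrFun hfp.hasFPowerSeriesAt.eq_zero n
    have h2 := congrArg (fun m : ContinuousMultilinearMap ℂ (fun _ : Fin n => ℂ) ℂ =>
      m fun _ => 1) this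
    simpa [hq] using h2
  -- a polynomial that vanishes near the origin is zero
  have hnhds : (WithLp.toLp 2 : (Fin d → ℂ) → EuclideanSpace ℂ (Fin d)) ⁻¹' Metric.ball 0 1 ∈
      nhds (0 : Fin d → ℂ) := by
    refine (PiLp.continuous_toLp 2 _).continuousAt.preimage_mem_nhds ?_
    exact Metric.ball_mem_nhds _ one_pos
  obtain ⟨ε, hε, hball⟩ := Metric.mem_nhds_iff.1 hnhds
  funext α
  set n := ∑ i, α i with hn
  let P : MvPolynomial (Fin d) ℂ := ∑ β ∈ Finset.piAntidiag Finset.univ n,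
    MvPolynomial.monomial (Finsupp.equivFunOnFinite.symm β) (c β)
  have hP : P = 0 := by
    refine MvPolynomial.funext_set (fun _ => Metric.ball (0 : ℂ) ε)
      (fun _ => infinite_of_mem_nhds 0 (Metric.ball_mem_nhds _ hε)) fun x hx => ?_
    have hx' : x ∈ Metric.ball (0 : Fin d → ℂ) ε := by
      rw [ball_pi _ hε]; exact hx
    have := key n ⟨WithLp.toLp 2 x, hball hx'⟩
    simp only [P, map_sum, map_zero, MvPolynomial.eval_monomial]
    rw [← this]
    refine Finset.sum_congr rfl fun β _ => ?_
    rw [Finsupp.prod_fintype _ _ (by simp)]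
    simp [zpowMulti, mul_comm]
  have hc := congrArg (MvPolynomial.coeff (Finsupp.equivFunOnFinite.symm α)) hP
  simp only [P, MvPolynomial.coeff_sum, MvPolynomial.coeff_monomial,
    EmbeddingLike.apply_eq_iff_eq, MvPolynomial.coeff_zero] at hc
  rw [Finset.sum_ite_eq' ] at hc
  simpa [hn] using hc

section Model

variable {d : ℕ} {K : Type*} [NormedAddCommGroup K] [InnerProductSpace ℂ K] [CompleteSpace K]
  (S : Fin d → K →L[ℂ] K)

/-- The joint cokernel `E = ⋂_j ker S_j^*`. -/
def jointCokernel : Submodule ℂ K := ⨅ j, LinearMap.ker (ContinuousLinearMap.adjoint (S j)).toLinearMap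

/-- `S^α = S_1^{α_1} ⋯ S_d^{α_d}`. -/
def tuplePow (α : Fin d → ℕ) : K →L[ℂ] K := (List.ofFn fun j => S j ^ α j).prod

/-- `F(z) = ∑_α f_α z^α` on the unit ball and `∑_α ‖S^α f_α‖^2 < ∞`. -/
def IsExpansion (F : CBall d → jointCokernel S) (f : (Fin d → ℕ) → jointCokernel S) : Prop :=
  (∀ z : CBall d, HasSum (fun α => zpowMulti z.1 α • f α) (F z)) ∧
    Summable fun α => ‖tuplePow S α (f α : K)‖ ^ 2

variable {S}

theorem IsExpansion.unique {F : CBall d → jointCokernel S} {f g : (Fin d → ℕ) → jointCokernel S}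
    (hf : IsExpansion S F f) (hg : IsExpansion S F g) : f = g := by
  funext α
  refine ext_inner_left ℂ fun e => ?_
  rw [← sub_eq_zero, ← inner_sub_right]
  refine congrFun (scalar_coeff_eq_zero (fun α => inner ℂ e (f α - g α)) fun z => ?_) α
  have h := ((hf.1 z).sub (hg.1 z)).mapL (innerSL ℂ e)
  simpa [inner_smul_right, inner_sub_right, mul_sub] using h

theorem summable_norm_sq_add {ι : Type*} {x y : ι → K} (hx : Summable fun i => ‖x i‖ ^ 2)
    (hy : Summable fun i => ‖y i‖ ^ 2) : Summable fun i => ‖x i + y i‖ ^ 2 := by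
  refine Summable.of_nonneg_of_le (fun _ => by positivity) (fun i => ?_)
    ((hx.mul_left 2).add (hy.mul_left 2))
  have := norm_add_le (x i) (y i)
  nlinarith [sq_nonneg (‖x i‖ - ‖y i‖), norm_nonneg (x i + y i), norm_nonneg (x i),
    norm_nonneg (y i)]

theorem summable_inner_of_sq {ι : Type*} {x y : ι → K} (hx : Summable fun i => ‖x i‖ ^ 2)
    (hy : Summable fun i => ‖y i‖ ^ 2) : Summable fun i => inner ℂ (x i) (y i) := by
  refine Summable.of_norm_bounded (hx.add hy) fun i => (norm_inner_le_norm _ _).trans ?_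
  nlinarith [sq_nonneg (‖x i‖ - ‖y i‖), sq_nonneg (‖x i‖ + ‖y i‖)]

theorem IsExpansion.add {F G : CBall d → jointCokernel S} {f g : (Fin d → ℕ) → jointCokernel S}
    (hf : IsExpansion S F f) (hg : IsExpansion S G g) : IsExpansion S (F + G) (f + g) :=
  ⟨fun z => by simpa using (hf.1 z).add (hg.1 z),
    by simpa using summable_norm_sq_add hf.2 hg.2⟩

theorem IsExpansion.smul {F : CBall d → jointCokernel S} {f : (Fin d → ℕ) → jointCokernel S}
    (c : ℂ) (hf : IsExpansion S F f) : IsExpansion S (c • F) (c • f) :=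
  ⟨fun z => by simpa [smul_comm c] using (hf.1 z).const_smul c,
    by simpa [norm_smul, mul_pow] using hf.2.mul_left (‖c‖ ^ 2)⟩

theorem IsExpansion.zero : IsExpansion S 0 0 :=
  ⟨fun z => by simp, by simp⟩

variable (S)

/-- The `jointCokernel S`-valued functions `F(z) = ∑_α f_α z^α` on the unit ball with
`∑_α ‖S^α f_α‖^2 < ∞`. -/
def modelSubmodule : Submodule ℂ (CBall d → jointCokernel S) where
  carrier := {F | ∃ f, IsExpansion S F f}
  add_mem' := fun ⟨f, hf⟩ ⟨g, hg⟩ => ⟨f + g, hf.add hg⟩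
  zero_mem' := ⟨0, IsExpansion.zero⟩
  smul_mem' := fun c _ ⟨f, hf⟩ => ⟨c • f, hf.smul c⟩

/-- The model space of `S`: the space `modelSubmodule S` of vector-valued holomorphic functions on the
unit ball, with the inner product `⟨F, G⟩ = ∑_α ⟨S^α f_α, S^α g_α⟩`. The operators `S_j` become the
multiplications by the coordinates `z_j`, and `jointCokernel S` becomes the space of the constant
functions. -/
def AnalyticModel : Type _ := modelSubmodule S

namespace AnalyticModel

instance : AddCommGroup (AnalyticModel S) := inferInstanceAs (AddCommGroup (modelSubmodule S))

instance : Module ℂ (AnalyticModel S) := inferInstanceAs (Module ℂ (modelSubmodule S))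

variable {S}

/-- The function on the ball. -/
def toFun (F : AnalyticModel S) : CBall d → jointCokernel S := F.1

/-- The coefficients `f_α` of `F(z) = ∑_α f_α z^α`; they are unique. -/
def coeff (F : AnalyticModel S) : (Fin d → ℕ) → jointCokernel S := F.2.choose

theorem isExpansion_coeff (F : AnalyticModel S) : IsExpansion S F.toFun F.coeff :=
  F.2.choose_spec

theorem coeff_eq {F : AnalyticModel S} {f : (Fin d → ℕ) → jointCokernel S}
    (h : IsExpansion S F.toFun f) : F.coeff = f := F.isExpansion_coeff.unique h

theorem coeff_add (F G : AnalyticModel S) : (F + G).coeff = F.coeff + G.coeff :=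
  coeff_eq (F.isExpansion_coeff.add G.isExpansion_coeff)

theorem coeff_smul (c : ℂ) (F : AnalyticModel S) : (c • F).coeff = c • F.coeff :=
  coeff_eq (F.isExpansion_coeff.smul c)

instance instCore : PreInnerProductSpace.Core ℂ (AnalyticModel S) where
  inner F G := ∑' α, inner ℂ (tuplePow S α (F.coeff α : K)) (tuplePow S α (G.coeff α : K))
  conj_inner_symm F G := by
    rw [Complex.conj_tsum]
    simp [inner_conj_symm]
  re_inner_nonneg F := by
    have h : (∑' α, inner ℂ (tuplePow S α (F.coeff α : K)) (tuplePow S α (F.coeff α : K)))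
        = ((∑' α, ‖tuplePow S α (F.coeff α : K)‖ ^ 2 : ℝ) : ℂ) := by
      rw [Complex.ofReal_tsum]
      simp [inner_self_eq_norm_sq_to_K]
    rw [h]
    exact tsum_nonneg fun _ => by positivity
  add_left F G H := by
    rw [← Summable.tsum_add]
    · refine tsum_congr fun α => ?_
      have h : tuplePow S α ((F + G).coeff α : K)
          = tuplePow S α (F.coeff α : K) + tuplePow S α (G.coeff α : K) := by
        rw [coeff_add]; simp
      rw [h, inner_add_left]
    · exact summable_inner_of_sq F.isExpansion_coeff.2 H.isExpansion_coeff.2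
    · exact summable_inner_of_sq G.isExpansion_coeff.2 H.isExpansion_coeff.2
  smul_left F G c := by
    rw [← tsum_mul_left]
    refine tsum_congr fun α => ?_
    have h : tuplePow S α ((c • F).coeff α : K) = c • tuplePow S α (F.coeff α : K) := by
      rw [coeff_smul]; simp
    rw [h, inner_smul_left]

/-- The norm `‖F‖^2 = ∑_α ‖S^α f_α‖^2`. (It is positive definite if the operators `S_j` are
injective, as for the multishifts with positive weights on leafless trees.) -/
instance : SeminormedAddCommGroup (AnalyticModel S) :=
  InnerProductSpace.Core.toSeminormedAddCommGroup (𝕜 := ℂ)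

instance : InnerProductSpace ℂ (AnalyticModel S) := InnerProductSpace.ofCore instCore

/-- The element `z^α f` of the model space, where `f` is a constant function. -/
def monomial (α : Fin d → ℕ) (f : jointCokernel S) : AnalyticModel S :=
  ⟨fun z => zpowMulti z.1 α • f, by
    classical
    refine ⟨Pi.single α f, fun z => ?_, ?_⟩
    · have := hasSum_single (f := fun β => zpowMulti z.1 β • (Pi.single α f : _ → jointCokernel S) β)
        α fun β hβ => by simp [hβ]
      simpa using this
    · refine summable_of_ne_finset_zero (s := {α}) fun β hβ => ?_
      have : β ≠ α := by simpa using hβ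
      simp [this]⟩

end AnalyticModel

/-! ### Representing measures -/

/-- The scalar measure `A ↦ ⟨μ(A) f, f⟩` of an operator-valued measure whose values are positive
operators. -/
def scalarMeasure {X : Type*} [MeasurableSpace X] {H : Type*} [NormedAddCommGroup H]
    [InnerProductSpace ℂ H] (μ : VectorMeasure X (H →L[ℂ] H)) (f : H) : SignedMeasure X :=
  μ.mapRange
    { toFun := fun A => (inner ℂ f (A f)).re
      map_zero' := by simp
      map_add' := fun A B => by simp }
    (Complex.continuous_re.comp (continuous_const.inner (by fun_prop)))

end Model

/-- The operator-valued measure `μ` is a representing measure, supported on `[0, b] × ∂𝔹^d`, of the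
analytic model of the multishift with weights `lam`, with the diagonal entries `ρ_u × ν_u`,
`u ∈ Ω_F`, `F ⊆ {1, …, d}`. -/
structure IsRepresentingMeasure {d : ℕ} {V : Fin d → Type*} (T : ∀ j, RootedDirectedTree (V j))
    (lam : Fin d → (∀ i, V i) → ℝ) (Om : Finset (Fin d) → Set (∀ i, V i)) (b : ℝ)
    (μ : VectorMeasure (ℝ × CSphere d)
      (jointCokernel (TreeProduct.multishift T lam) →L[ℂ] jointCokernel (TreeProduct.multishift T lam)))
    (ρ : (∀ i, V i) → Measure ℝ) (ν : (∀ i, V i) → Measure (CSphere d)) : Prop where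
  b_pos : 0 < b
  supported : ∀ A, MeasurableSet A → Disjoint A (Set.Icc 0 b ×ˢ Set.univ) → μ A = 0
  isPositive : ∀ A, (μ A).IsPositive
  finite_rho : ∀ F, ∀ u ∈ Om F, IsFiniteMeasure (ρ u)
  finite_nu : ∀ F, ∀ u ∈ Om F, IsFiniteMeasure (ν u)
  /-- Integral representation. -/
  integral_repr : ∀ (f : jointCokernel (TreeProduct.multishift T lam)) (α : Fin d → ℕ),
    (scalarMeasure μ f).Integrable
        (fun p : ℝ × CSphere d => p.1 ^ (∑ i, α i) * ‖zpowMulti p.2.1 α‖ ^ 2) ∧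
      ‖AnalyticModel.monomial α f‖ ^ 2 =
        ∫ᵛ p, p.1 ^ (∑ i, α i) * ‖zpowMulti p.2.1 α‖ ^ 2 ∂•(scalarMeasure μ f)
  /-- Diagonal measure: `(ρ × ν)(A) (∑ g_{u,F}) = ∑ (ρ_u × ν_u)(A) g_{u,F}` for `g_{u,F} ∈ L_{u,F}`,
  the sums being taken over all `F` and all `u ∈ Ω_F`. -/
  diagonal : ∀ A, MeasurableSet A →
    ∀ (g : (F : Finset (Fin d)) → Om F → jointCokernel (TreeProduct.multishift T lam))
      (f : jointCokernel (TreeProduct.multishift T lam)),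
    (∀ F u, (g F u : SqSum (∀ i, V i)) ∈ TreeProduct.solutionSpace T lam F u.1) →
    HasSum (fun p : (F : Finset (Fin d)) × Om F => g p.1 p.2) f →
    HasSum (fun p : (F : Finset (Fin d)) × Om F =>
      (((ρ p.2.1).prod (ν p.2.1)).real A : ℂ) • g p.1 p.2) (μ A f)
  /-- Normalization. -/
  prob_rho : IsProbabilityMeasure (ρ (TreeProduct.root T))
  prob_nu : IsProbabilityMeasure (ν (TreeProduct.root T))

/-! ### The explicit measures -/

/-- The normalized surface area measure on the unit sphere of `ℂ^d`. -/
def sphereMeasure (d : ℕ) : Measure (CSphere d) :=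
  ((volume : Measure (EuclideanSpace ℂ (Fin d))).toSphere Set.univ)⁻¹ •
    (volume : Measure (EuclideanSpace ℂ (Fin d))).toSphere

/-- `ω_l(s) = (l + a) ⋯ (l + d - 1) ∑_{i = a}^{d - 1} s^{i + l - 1} / ∏_{a ≤ j ≠ i ≤ d - 1} (j - i)`. -/
def omegaWeight (a d l : ℕ) (s : ℝ) : ℝ :=
  (∏ i ∈ Finset.Ico a d, ((l : ℝ) + i)) *
    ∑ i ∈ Finset.Ico a d, s ^ (i + l - 1) / ∏ j ∈ (Finset.Ico a d).erase i, ((j : ℝ) - i)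

/-- `ω_l(s) ds` on `[0, 1]`. -/
def radialMeasure (a d l : ℕ) : Measure ℝ :=
  (volume.restrict (Set.Icc (0 : ℝ) 1)).withDensity fun s => ENNReal.ofReal (omegaWeight a d l s)

/-- `|z^β|^2 / ‖z^β‖^2 dσ(z)`, with the norm of `L^2(∂𝔹^d, σ)`. -/
def sphericalMeasure (d : ℕ) (β : Fin d → ℕ) : Measure (CSphere d) :=
  (sphereMeasure d).withDensity fun z =>
    ENNReal.ofReal (‖zpowMulti z.1 β‖ ^ 2 / ∫ w, ‖zpowMulti w.1 β‖ ^ 2 ∂(sphereMeasure d))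

end

/-!
Suppose `∑_{w ∈ Chi_j(v)} λ_j(w)^2 = W(d_v + ε_j) / W(d_v)` for a function `W` on `ℕ^d`, where `ε_j`
is the `j`-th unit vector. Then the multishift `S` moves functions supported at depth `β` to depth
`β + α` under `S^α` and multiplies their squared norms by `W(β + α) / W(β)`. The Drury-Arveson-type
multishift has this property with `W_a(β) = (a - 1)! β! / (|β| + a - 1)!`, and hence its spherical
Cauchy dual has it with `W_d^2 / W_a`.

This quotient is `W_d(β)`, which is `∫ |z^β|^2 dσ` over the sphere, times a multiple of
`(|β| + a - 1)! / (|β| + d - 1)!`, which is a moment of a beta density on `[0, 1]`; as the partial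
fraction sum in `ω_l(s)` is the binomial expansion of a power of `1 - s`, the density
`ω_{|β|}` is that beta density. So `ρ_β × ν_β` has the moments `W(β + α) / W(β)`. Finite branching
makes `E` the orthogonal sum of finitely many parts of constant depth `β`, with projections `P_β`,
and `μ = ∑_β (ρ_β × ν_β) P_β`.
-/

open scoped Nat

theorem integral_volumeIoiPow (n : ℕ) (g : ℝ → ℝ) :
    ∫ r : Set.Ioi (0 : ℝ), g r ∂(Measure.volumeIoiPow n) = ∫ r in Set.Ioi (0 : ℝ), r ^ n * g r := by
  have hmeas : Measurable fun r : Set.Ioi (0 : ℝ) => ENNReal.ofReal (r.1 ^ n) := by fun_prop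
  rw [Measure.volumeIoiPow, integral_withDensity_eq_integral_toReal_smul hmeas (by simp),
    ← integral_subtype_comap measurableSet_Ioi]
  refine integral_congr_ae (.of_forall fun r => ?_)
  simp only [ENNReal.toReal_ofReal (pow_nonneg (Set.mem_Ioi.1 r.2).le n), smul_eq_mul]

theorem integral_eq_integral_toSphere_mul_integral {E : Type*} [NormedAddCommGroup E]
    [NormedSpace ℝ E] [FiniteDimensional ℝ E] [MeasurableSpace E] [BorelSpace E] [Nontrivial E]
    (μ : Measure E) [μ.IsAddHaarMeasure] (F : E → ℝ) (f : Metric.sphere (0 : E) 1 → ℝ) (g : ℝ → ℝ)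
    (hF : ∀ (u : Metric.sphere (0 : E) 1) (r : ℝ), 0 < r → F (r • u.1) = f u * g r) :
    ∫ x, F x ∂μ = (∫ u, f u ∂μ.toSphere) *
      ∫ r in Set.Ioi (0 : ℝ), r ^ (Module.finrank ℝ E - 1) * g r := by
  have hpolar (x : ({0}ᶜ : Set E)) : F x.1 =
      f (homeomorphUnitSphereProd E x).1 * g (homeomorphUnitSphereProd E x).2.1 := by
    have hx : ‖x.1‖ ≠ 0 := norm_ne_zero_iff.2 x.2
    rw [← hF _ _ (homeomorphUnitSphereProd E x).2.2]
    simp [smul_smul, hx]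
  calc ∫ x, F x ∂μ
      = ∫ x : ({0}ᶜ : Set E), F x.1 ∂(μ.comap (↑)) := by
        rw [integral_subtype_comap (measurableSet_singleton _).compl, restrict_compl_singleton]
    _ = ∫ p, f p.1 * g p.2.1 ∂(μ.toSphere.prod (.volumeIoiPow (Module.finrank ℝ E - 1))) := by
        simp only [hpolar]
        exact μ.measurePreserving_homeomorphUnitSphereProd.integral_comp
          (Homeomorph.measurableEmbedding _) fun p => f p.1 * g p.2.1
    _ = _ := by
        rw [integral_prod_mul f fun r : Set.Ioi (0 : ℝ) => g r, integral_volumeIoiPow]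

theorem integral_pow_mul_exp_neg_sq (n : ℕ) :
    ∫ r in Set.Ioi (0 : ℝ), r ^ (2 * n + 1) * Real.exp (-r ^ 2) = n ! / 2 := by
  have h := integral_rpow_mul_exp_neg_rpow (p := 2) (q := ((2 * n + 1 : ℕ) : ℝ)) (by norm_num)
    (neg_one_lt_zero.trans_le (Nat.cast_nonneg _))
  have hq : (((2 * n + 1 : ℕ) : ℝ) + 1) / 2 = n + 1 := by push_cast; ring
  rw [hq, Real.Gamma_nat_eq_factorial] at h
  simp only [Real.rpow_natCast, Real.rpow_two] at h
  rw [h]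
  ring

theorem integral_complex_pow_mul_exp_neg_sq (n : ℕ) :
    ∫ z : ℂ, ‖z‖ ^ (2 * n) * Real.exp (-‖z‖ ^ 2) = Real.pi * n ! := by
  have h := Complex.integral_rpow_mul_exp_neg_rpow (p := 2) (q := ((2 * n : ℕ) : ℝ)) (by norm_num)
    (lt_of_lt_of_le (by norm_num) (Nat.cast_nonneg _))
  have hq : (((2 * n : ℕ) : ℝ) + 2) / 2 = n + 1 := by push_cast; ring
  rw [hq, Real.Gamma_nat_eq_factorial] at h
  simp only [Real.rpow_natCast, Real.rpow_two] at h
  rw [h]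
  ring

theorem exists_integral_euclideanSpace_eq_mul (d : ℕ) : ∃ c : ℝ, ∀ f : (Fin d → ℂ) → ℝ,
    ∫ z : EuclideanSpace ℂ (Fin d), f z.ofLp = c * ∫ x, f x := by
  let e : EuclideanSpace ℂ (Fin d) ≃L[ℝ] (Fin d → ℂ) := PiLp.continuousLinearEquiv 2 ℝ _
  let μ := (volume : Measure (EuclideanSpace ℂ (Fin d))).map e
  have : μ.IsAddHaarMeasure := e.isAddHaarMeasure_map volume
  refine ⟨μ.addHaarScalarFactor volume, fun f => ?_⟩
  calc ∫ z : EuclideanSpace ℂ (Fin d), f z.ofLp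
      = ∫ x, f x ∂μ := (e.toHomeomorph.measurableEmbedding.integral_map f).symm
    _ = ∫ x, f x ∂(μ.addHaarScalarFactor volume • volume) := by
        rw [← Measure.isAddLeftInvariant_eq_smul μ volume]
    _ = _ := integral_smul_nnreal_measure f _

theorem finrank_euclideanSpace_complex (d : ℕ) :
    Module.finrank ℝ (EuclideanSpace ℂ (Fin d)) = 2 * d := by
  rw [← Module.finrank_mul_finrank ℝ ℂ, Complex.finrank_real_complex, finrank_euclideanSpace_fin]

theorem zpowMulti_smul {d : ℕ} (r : ℝ) (z : EuclideanSpace ℂ (Fin d)) (β : Fin d → ℕ) :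
    zpowMulti (r • z) β = (r : ℂ) ^ (∑ i, β i) * zpowMulti z β := by
  simp [zpowMulti, mul_pow, Finset.prod_mul_distrib, Finset.prod_pow_eq_pow_sum]

theorem zpowMulti_add {d : ℕ} (z : EuclideanSpace ℂ (Fin d)) (α β : Fin d → ℕ) :
    zpowMulti z (α + β) = zpowMulti z α * zpowMulti z β := by
  simp only [zpowMulti, Pi.add_apply, pow_add, Finset.prod_mul_distrib]

theorem norm_zpowMulti_le_one {d : ℕ} (z : CSphere d) (β : Fin d → ℕ) :
    ‖zpowMulti z.1 β‖ ≤ 1 := by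
  rw [zpowMulti, norm_prod]
  refine Finset.prod_le_one (fun _ _ => norm_nonneg _) fun i _ => ?_
  rw [norm_pow]
  exact pow_le_one₀ (norm_nonneg _) ((PiLp.norm_apply_le z.1 i).trans (by simp))

theorem continuous_zpowMulti {d : ℕ} (β : Fin d → ℕ) :
    Continuous fun z : CSphere d => zpowMulti z.1 β := by
  unfold zpowMulti
  fun_prop

theorem exists_integral_zpowMulti_mul_exp_eq (d : ℕ) : ∃ c : ℝ, ∀ β : Fin d → ℕ,
    ∫ z : EuclideanSpace ℂ (Fin d), ‖zpowMulti z β‖ ^ 2 * Real.exp (-‖z‖ ^ 2) =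
      c * ∏ i, ((β i)! : ℝ) := by
  obtain ⟨c, hc⟩ := exists_integral_euclideanSpace_eq_mul d
  refine ⟨c * Real.pi ^ d, fun β => ?_⟩
  calc ∫ z : EuclideanSpace ℂ (Fin d), ‖zpowMulti z β‖ ^ 2 * Real.exp (-‖z‖ ^ 2)
      = ∫ z : EuclideanSpace ℂ (Fin d), ∏ i, ‖z i‖ ^ (2 * β i) * Real.exp (-‖z i‖ ^ 2) := by
        simp only [zpowMulti, norm_prod, norm_pow, ← Finset.prod_pow, ← pow_mul, mul_comm,
          Finset.prod_mul_distrib, ← Real.exp_sum, Finset.sum_neg_distrib,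
          EuclideanSpace.norm_sq_eq]
    _ = c * ∏ i, ∫ z : ℂ, ‖z‖ ^ (2 * β i) * Real.exp (-‖z‖ ^ 2) := by
        rw [hc fun x => ∏ i, ‖x i‖ ^ (2 * β i) * Real.exp (-‖x i‖ ^ 2),
          integral_fintype_prod_volume_eq_prod
            (f := fun i (z : ℂ) => ‖z‖ ^ (2 * β i) * Real.exp (-‖z‖ ^ 2))]
    _ = c * Real.pi ^ d * ∏ i, ((β i)! : ℝ) := by
        simp [integral_complex_pow_mul_exp_neg_sq, Finset.prod_mul_distrib, mul_assoc]

/-- The squared norm `(a - 1)! β! / (|β| + a - 1)!` of `z^β` in the Hilbert space of holomorphic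
functions on the ball with the reproducing kernel `(1 - ⟨z, w⟩)^{-a}`, for `a ≥ 1`. -/
noncomputable def kernelNormSq {d : ℕ} (a : ℕ) (β : Fin d → ℕ) : ℝ :=
  (a - 1)! * (∏ i, ((β i)! : ℝ)) / ((∑ i, β i) + a - 1)!

theorem kernelNormSq_pos {d : ℕ} (a : ℕ) (β : Fin d → ℕ) : 0 < kernelNormSq a β := by
  unfold kernelNormSq
  positivity

theorem exists_integral_zpowMulti_toSphere_eq {d : ℕ} (hd : 0 < d) :
    ∃ c : ℝ, ∀ β : Fin d → ℕ,
      ∫ u : CSphere d, ‖zpowMulti u.1 β‖ ^ 2 ∂volume.toSphere = c * kernelNormSq d β := by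
  have : Nonempty (Fin d) := ⟨⟨0, hd⟩⟩
  obtain ⟨c, hc⟩ := exists_integral_zpowMulti_mul_exp_eq d
  refine ⟨2 * c / (d - 1)!, fun β => ?_⟩
  have hpolar := integral_eq_integral_toSphere_mul_integral volume
    (fun z => ‖zpowMulti z β‖ ^ 2 * Real.exp (-‖z‖ ^ 2)) (fun u => ‖zpowMulti u.1 β‖ ^ 2)
    (fun r => r ^ (2 * ∑ i, β i) * Real.exp (-r ^ 2)) fun u r hr => by
      have hu : ‖u.1‖ = 1 := by simp
      simp only [zpowMulti_smul, norm_mul, norm_pow, norm_smul, hu, Complex.norm_real,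
        Real.norm_eq_abs, mul_one, abs_of_pos hr]
      ring
  have hpow (r : ℝ) : r ^ (2 * d - 1) * (r ^ (2 * ∑ i, β i) * Real.exp (-r ^ 2)) =
      r ^ (2 * (∑ i, β i + d - 1) + 1) * Real.exp (-r ^ 2) := by
    rw [← mul_assoc, ← pow_add]
    congr 2
    lia
  simp only [hc, finrank_euclideanSpace_complex, hpow, integral_pow_mul_exp_neg_sq] at hpolar
  rw [kernelNormSq]
  field_simp
  linear_combination -2 * hpolar

theorem isProbabilityMeasure_sphereMeasure {d : ℕ} (hd : 0 < d) :
    IsProbabilityMeasure (sphereMeasure d) := by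
  have : Nonempty (Fin d) := ⟨⟨0, hd⟩⟩
  refine ⟨?_⟩
  rw [sphereMeasure, Measure.smul_apply, smul_eq_mul]
  exact ENNReal.inv_mul_cancel (Measure.measure_univ_ne_zero.2 (Measure.toSphere_ne_zero _))
    (measure_ne_top _ _)

instance isFiniteMeasure_sphereMeasure (d : ℕ) : IsFiniteMeasure (sphereMeasure d) := by
  constructor
  rw [sphereMeasure, Measure.smul_apply, smul_eq_mul]
  exact (ENNReal.inv_mul_le_one _).trans_lt ENNReal.one_lt_top

theorem integral_zpowMulti_sphereMeasure {d : ℕ} (hd : 0 < d) (β : Fin d → ℕ) :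
    ∫ z, ‖zpowMulti z.1 β‖ ^ 2 ∂(sphereMeasure d) = kernelNormSq d β := by
  have := isProbabilityMeasure_sphereMeasure hd
  obtain ⟨c, hc⟩ : ∃ c : ℝ, ∀ β : Fin d → ℕ,
      ∫ z, ‖zpowMulti z.1 β‖ ^ 2 ∂(sphereMeasure d) = c * kernelNormSq d β := by
    obtain ⟨c, hc⟩ := exists_integral_zpowMulti_toSphere_eq hd
    refine ⟨((volume : Measure (EuclideanSpace ℂ (Fin d))).toSphere Set.univ)⁻¹.toReal * c,
      fun β => ?_⟩
    rw [sphereMeasure, integral_smul_measure, hc, smul_eq_mul, ← mul_assoc]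
  have hc_one : c = 1 := by
    simpa [zpowMulti, kernelNormSq, Nat.factorial_ne_zero] using (hc 0).symm
  rw [hc, hc_one, one_mul]

theorem integrable_zpowMulti_sq {d : ℕ} (μ : Measure (CSphere d)) [IsFiniteMeasure μ]
    (β : Fin d → ℕ) : Integrable (fun z => ‖zpowMulti z.1 β‖ ^ 2) μ :=
  .of_bound ((continuous_zpowMulti β).norm.pow 2).aestronglyMeasurable 1
    (.of_forall fun z => by simpa using norm_zpowMulti_le_one z β)

instance isFiniteMeasure_sphericalMeasure (d : ℕ) (β : Fin d → ℕ) :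
    IsFiniteMeasure (sphericalMeasure d β) :=
  isFiniteMeasure_withDensity_ofReal ((integrable_zpowMulti_sq _ β).div_const _).2

theorem integral_zpowMulti_sphericalMeasure {d : ℕ} (hd : 0 < d) (α β : Fin d → ℕ) :
    ∫ z, ‖zpowMulti z.1 α‖ ^ 2 ∂(sphericalMeasure d β) =
      kernelNormSq d (β + α) / kernelNormSq d β := by
  have hmeas := (continuous_zpowMulti β).measurable
  simp only [sphericalMeasure, integral_zpowMulti_sphereMeasure hd]
  rw [integral_withDensity_eq_integral_toReal_smul (by fun_prop) (by simp),
    ← integral_zpowMulti_sphereMeasure hd (β + α), ← integral_div]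
  refine integral_congr_ae (.of_forall fun z => ?_)
  have hdens : 0 ≤ ‖zpowMulti z.1 β‖ ^ 2 / kernelNormSq d β :=
    div_nonneg (by positivity) (kernelNormSq_pos d β).le
  simp only [ENNReal.toReal_ofReal hdens, smul_eq_mul, zpowMulti_add, norm_mul, mul_pow]
  ring

theorem isProbabilityMeasure_sphericalMeasure {d : ℕ} (hd : 0 < d) (β : Fin d → ℕ) :
    IsProbabilityMeasure (sphericalMeasure d β) := by
  have h := integral_zpowMulti_sphericalMeasure hd 0 β
  rw [add_zero, div_self (kernelNormSq_pos d β).ne'] at h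
  simpa [isProbabilityMeasure_iff_real, zpowMulti] using h

theorem integral_pow_mul_one_sub_pow (p q : ℕ) :
    ∫ s in (0 : ℝ)..1, s ^ p * (1 - s) ^ q = p ! * q ! / (p + q + 1)! := by
  induction q generalizing p with
  | zero =>
    simp only [pow_zero, mul_one, integral_pow, one_pow, zero_pow p.succ_ne_zero, sub_zero,
      Nat.factorial_zero, Nat.cast_one, add_zero, Nat.factorial_succ, Nat.cast_mul, Nat.cast_add]
    field_simp
  | succ q ih =>
    have hsplit (s : ℝ) :
        s ^ p * (1 - s) ^ (q + 1) = s ^ p * (1 - s) ^ q - s ^ (p + 1) * (1 - s) ^ q := by ring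
    have hint (m : ℕ) : IntervalIntegrable (fun s : ℝ => s ^ m * (1 - s) ^ q) volume 0 1 :=
      Continuous.intervalIntegrable (by fun_prop) _ _
    simp only [hsplit]
    rw [intervalIntegral.integral_sub (hint p) (hint (p + 1)), ih, ih,
      show p + 1 + q + 1 = p + q + 1 + 1 by ring, show p + (q + 1) + 1 = p + q + 1 + 1 by ring]
    simp only [Nat.factorial_succ]
    push_cast
    field_simp
    ring

theorem prod_Ico_natCast_add {a d : ℕ} (ha : 0 < a) (had : a ≤ d) (l : ℕ) :
    ∏ i ∈ Finset.Ico a d, ((l : ℝ) + i) = (l + d - 1)! / (l + a - 1)! := by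
  induction d, had using Nat.le_induction with
  | base => simp [Nat.factorial_ne_zero]
  | succ d had ih =>
    have hfac : (l + (d + 1) - 1)! = (l + d) * (l + d - 1)! :=
      (Nat.mul_factorial_pred (by lia)).symm
    rw [Finset.prod_Ico_succ_top had, ih, hfac]
    push_cast
    ring

theorem prod_Ico_erase_natCast_sub {a d i : ℕ} (hai : a ≤ i) (hid : i < d) :
    ∏ j ∈ (Finset.Ico a d).erase i, ((j : ℝ) - i) =
      (-1) ^ (i - a) * (i - a)! * (d - 1 - i)! := by
  have hsplit : (Finset.Ico a d).erase i = Finset.Ico a i ∪ Finset.Ico (i + 1) d := by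
    ext j
    simp only [Finset.mem_erase, Finset.mem_Ico, Finset.mem_union]
    lia
  have hdisj : Disjoint (Finset.Ico a i) (Finset.Ico (i + 1) d) := by
    rw [Finset.disjoint_left]
    intro j
    simp only [Finset.mem_Ico]
    lia
  have hbelow : ∏ j ∈ Finset.Ico a i, ((j : ℝ) - i) = (-1) ^ (i - a) * (i - a)! := by
    obtain ⟨m, rfl⟩ := Nat.exists_eq_add_of_le hai
    rw [Finset.prod_Ico_eq_prod_range, ← Finset.prod_range_reflect, Nat.add_sub_cancel_left,
      ← Finset.prod_range_add_one_eq_factorial, Nat.cast_prod, Finset.pow_eq_prod_const,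
      ← Finset.prod_mul_distrib]
    refine Finset.prod_congr rfl fun t ht => ?_
    have : t + 1 ≤ m := Finset.mem_range.1 ht
    rw [Nat.sub_sub, add_comm 1]
    push_cast [this]
    ring
  have habove : ∏ j ∈ Finset.Ico (i + 1) d, ((j : ℝ) - i) = (d - 1 - i)! := by
    rw [Finset.prod_Ico_eq_prod_range, ← Finset.prod_range_add_one_eq_factorial, Nat.cast_prod,
      Nat.sub_sub, add_comm 1]
    refine Finset.prod_congr rfl fun t _ => ?_
    push_cast
    ring
  rw [hsplit, Finset.prod_union hdisj, hbelow, habove]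

theorem sum_pow_div_prod_erase_sub {a d : ℕ} (ha : 0 < a) (had : a < d) (l : ℕ) (s : ℝ) :
    ∑ i ∈ Finset.Ico a d, s ^ (i + l - 1) / ∏ j ∈ (Finset.Ico a d).erase i, ((j : ℝ) - i) =
      s ^ (l + a - 1) * (1 - s) ^ (d - 1 - a) / (d - 1 - a)! := by
  obtain ⟨n, rfl⟩ : ∃ n, d = a + n + 1 := Nat.exists_eq_add_of_lt had
  have hn : a + n + 1 - 1 - a = n := by lia
  rw [hn, Finset.sum_Ico_eq_sum_range, show a + n + 1 - a = n + 1 by lia, ← neg_add_eq_sub s 1,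
    add_pow, Finset.mul_sum, Finset.sum_div]
  refine Finset.sum_congr rfl fun m hm => ?_
  have hmn : m ≤ n := Nat.lt_succ_iff.1 (Finset.mem_range.1 hm)
  have hchoose : (n.choose m : ℝ) * m ! * (n - m)! = n ! := by
    exact_mod_cast Nat.choose_mul_factorial_mul_factorial hmn
  have hsign : ((-1 : ℝ) ^ m) * (-1) ^ m = 1 := by rw [← mul_pow]; simp
  rw [prod_Ico_erase_natCast_sub (by lia) (by lia), show a + m + l - 1 = l + a - 1 + m by lia,
    show a + m - a = m by lia, show a + n + 1 - 1 - (a + m) = n - m by lia, neg_pow s m, one_pow,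
    mul_one, pow_add, div_eq_div_iff (by positivity) (by positivity), ← hchoose]
  linear_combination
    (-(s ^ (l + a - 1) * s ^ m * n.choose m * m ! * (n - m)!)) * hsign

theorem omegaWeight_eq {a d : ℕ} (ha : 0 < a) (had : a < d) (l : ℕ) (s : ℝ) :
    omegaWeight a d l s = (l + d - 1)! / ((l + a - 1)! * (d - 1 - a)!) *
      (s ^ (l + a - 1) * (1 - s) ^ (d - 1 - a)) := by
  rw [omegaWeight, prod_Ico_natCast_add ha had.le, sum_pow_div_prod_erase_sub ha had]
  ring

theorem omegaWeight_nonneg {a d : ℕ} (ha : 0 < a) (had : a < d) (l : ℕ) {s : ℝ}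
    (hs : s ∈ Set.Icc (0 : ℝ) 1) : 0 ≤ omegaWeight a d l s := by
  have hs_nonneg : 0 ≤ s := hs.1
  have hs_le : 0 ≤ 1 - s := sub_nonneg.2 hs.2
  rw [omegaWeight_eq ha had]
  positivity

theorem continuous_omegaWeight (a d l : ℕ) : Continuous (omegaWeight a d l) := by
  unfold omegaWeight
  fun_prop

theorem integral_pow_radialMeasure {a d : ℕ} (ha : 0 < a) (had : a < d) (l k : ℕ) :
    ∫ s, s ^ k ∂(radialMeasure a d l) =
      ((l + k + a - 1)! / (l + k + d - 1)!) / ((l + a - 1)! / (l + d - 1)!) := by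
  have hcont := continuous_omegaWeight a d l
  calc ∫ s, s ^ k ∂(radialMeasure a d l)
      = ∫ s in Set.Icc (0 : ℝ) 1, omegaWeight a d l s * s ^ k := by
        rw [radialMeasure, integral_withDensity_eq_integral_toReal_smul (by fun_prop) (by simp)]
        refine setIntegral_congr_fun measurableSet_Icc fun s hs => ?_
        simp only [ENNReal.toReal_ofReal (omegaWeight_nonneg ha had l hs), smul_eq_mul]
    _ = ∫ s in (0 : ℝ)..1, (l + d - 1)! / ((l + a - 1)! * (d - 1 - a)!) *
          (s ^ (l + k + a - 1) * (1 - s) ^ (d - 1 - a)) := by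
        rw [intervalIntegral.integral_of_le zero_le_one, ← integral_Icc_eq_integral_Ioc]
        refine setIntegral_congr_fun measurableSet_Icc fun s _ => ?_
        simp only [omegaWeight_eq ha had, show l + k + a - 1 = l + a - 1 + k by lia, pow_add]
        ring
    _ = _ := by
        rw [intervalIntegral.integral_const_mul, integral_pow_mul_one_sub_pow,
          show l + k + a - 1 + (d - 1 - a) + 1 = l + k + d - 1 by lia]
        field_simp

theorem ae_mem_Icc_radialMeasure (a d l : ℕ) :
    ∀ᵐ s ∂(radialMeasure a d l), s ∈ Set.Icc (0 : ℝ) 1 :=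
  (withDensity_absolutelyContinuous _ _).ae_le (ae_restrict_mem measurableSet_Icc)

instance isFiniteMeasure_radialMeasure (a d l : ℕ) : IsFiniteMeasure (radialMeasure a d l) :=
  isFiniteMeasure_withDensity_ofReal (continuous_omegaWeight a d l).integrableOn_Icc.2

theorem isProbabilityMeasure_radialMeasure {a d : ℕ} (ha : 0 < a) (had : a < d) (l : ℕ) :
    IsProbabilityMeasure (radialMeasure a d l) := by
  have h := integral_pow_radialMeasure ha had l 0
  rw [add_zero, div_self (by positivity)] at h
  simpa [isProbabilityMeasure_iff_real] using h

theorem integrable_pow_radialMeasure (a d l k : ℕ) :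
    Integrable (fun s => s ^ k) (radialMeasure a d l) := by
  refine .of_bound (by fun_prop) 1 ?_
  filter_upwards [ae_mem_Icc_radialMeasure a d l] with s hs
  simpa [abs_of_nonneg hs.1] using pow_le_one₀ hs.1 hs.2

/-- The squared norms `‖S^β e_root‖^2` of the spherical Cauchy dual of the Drury-Arveson-type
multishift, up to a constant factor. -/
noncomputable def dualNormSq {d : ℕ} (a : ℕ) (β : Fin d → ℕ) : ℝ :=
  kernelNormSq d β ^ 2 / kernelNormSq a β

theorem dualNormSq_pos {d : ℕ} (a : ℕ) (β : Fin d → ℕ) : 0 < dualNormSq a β := by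
  have ha := kernelNormSq_pos a β
  have hd := kernelNormSq_pos d β
  unfold dualNormSq
  positivity

theorem integral_radialMeasure_prod_sphericalMeasure {a d : ℕ} (ha : 0 < a) (had : a < d)
    (α β : Fin d → ℕ) :
    ∫ p, p.1 ^ (∑ i, α i) * ‖zpowMulti p.2.1 α‖ ^ 2
        ∂((radialMeasure a d (∑ i, β i)).prod (sphericalMeasure d β)) =
      dualNormSq a (β + α) / dualNormSq a β := by
  rw [integral_prod_mul (L := ℝ) (fun s : ℝ => s ^ (∑ i, α i))
    (fun z : CSphere d => ‖zpowMulti z.1 α‖ ^ 2), integral_pow_radialMeasure ha had,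
    integral_zpowMulti_sphericalMeasure (ha.trans had)]
  simp only [dualNormSq, kernelNormSq, Pi.add_apply, Finset.sum_add_distrib]
  field_simp

theorem integrable_radialMeasure_prod_sphericalMeasure (a : ℕ) {d : ℕ} (l : ℕ) (α β : Fin d → ℕ) :
    Integrable (fun p : ℝ × CSphere d => p.1 ^ (∑ i, α i) * ‖zpowMulti p.2.1 α‖ ^ 2)
      ((radialMeasure a d l).prod (sphericalMeasure d β)) :=
  (integrable_pow_radialMeasure a d l _).mul_prod (integrable_zpowMulti_sq _ α)

namespace RootedDirectedTree

variable {V : Type*} (T : RootedDirectedTree V)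

theorem ne_root_of_adj {v w : V} (h : T.Adj v w) : w ≠ T.root := fun e => T.not_adj_root v (e ▸ h)

theorem parent_adj {v : V} (h : v ≠ T.root) : T.Adj (T.parent v) v := by
  rw [parent, dif_neg h]
  exact (T.existsUnique_parent v h).choose_spec.1

theorem parent_eq_of_adj {v w : V} (h : T.Adj v w) : T.parent w = v :=
  (T.existsUnique_parent w (T.ne_root_of_adj h)).unique (T.parent_adj (T.ne_root_of_adj h)) h

theorem generation_unique {v : V} {m n : ℕ} (hm : v ∈ T.generation m) (hn : v ∈ T.generation n) :
    m = n := by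
  induction m generalizing n v with
  | zero =>
    cases n with
    | zero => rfl
    | succ n =>
      obtain ⟨u, -, huv⟩ := hn
      exact absurd hm (T.ne_root_of_adj huv)
  | succ m ih =>
    obtain ⟨u, hu, huv⟩ := hm
    cases n with
    | zero => exact absurd hn (T.ne_root_of_adj huv)
    | succ n =>
      obtain ⟨u', hu', hu'v⟩ := hn
      obtain rfl : u' = u := (T.parent_eq_of_adj hu'v).symm.trans (T.parent_eq_of_adj huv)
      rw [ih hu hu']

theorem mem_generation_depth (v : V) : v ∈ T.generation (T.depth v) := by
  classical
  exact Nat.find_spec (T.exists_mem_generation v)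

theorem depth_of_adj {v w : V} (h : T.Adj v w) : T.depth w = T.depth v + 1 :=
  T.generation_unique (T.mem_generation_depth w) ⟨v, T.mem_generation_depth v, h⟩

theorem depth_root : T.depth T.root = 0 :=
  T.generation_unique (T.mem_generation_depth _) rfl

theorem depth_lt_of_nontrivial_children {N : ℕ} (hN : T.branchingIndex ≤ N) {v : V}
    (hv : (T.children v).Nontrivial) : T.depth v < N := by
  have h : (T.depth v : ℕ∞) + 1 ≤ N :=
    (le_iSup₂ (f := fun w (_ : w ∈ {v : V | (T.children v).Nontrivial}) =>
      (T.depth w : ℕ∞) + 1) v hv).trans hN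
  exact_mod_cast h

theorem children_parent_eq_singleton {N : ℕ} (hN : T.branchingIndex ≤ N) {v : V}
    (hv : N < T.depth v) : T.children (T.parent v) = {v} := by
  have hroot : v ≠ T.root := by
    rintro rfl
    simp [T.depth_root] at hv
  have hadj := T.parent_adj hroot
  have hdepth := T.depth_of_adj hadj
  have hsub : (T.children (T.parent v)).Subsingleton :=
    Set.not_nontrivial_iff.1 fun hnt => by
      have := T.depth_lt_of_nontrivial_children hN hnt
      omega
  exact hsub.eq_singleton_of_mem hadj

end RootedDirectedTree

namespace TreeProduct

variable {d : ℕ} {V : Fin d → Type*} {T : ∀ j, RootedDirectedTree (V j)}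

theorem ne_root_of_mem_chi {j : Fin d} {v w : ∀ i, V i} (h : w ∈ chi T j v) :
    w j ≠ (T j).root := by
  obtain ⟨η, hη, rfl⟩ := h
  rw [Function.update_self]
  exact (T j).ne_root_of_adj hη

theorem par_eq_of_mem_chi {j : Fin d} {v w : ∀ i, V i} (h : w ∈ chi T j v) : par T j w = v := by
  obtain ⟨η, hη, rfl⟩ := h
  simp [par, (T j).parent_eq_of_adj hη]

theorem mem_chi_iff {j : Fin d} {v w : ∀ i, V i} :
    w ∈ chi T j v ↔ w j ≠ (T j).root ∧ par T j w = v :=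
  ⟨fun h => ⟨ne_root_of_mem_chi h, par_eq_of_mem_chi h⟩, fun h => h.2 ▸ mem_chi_par T h.1⟩

theorem depth_of_mem_chi {j : Fin d} {v w : ∀ i, V i} (h : w ∈ chi T j v) :
    depth T w = depth T v + Pi.single j 1 := by
  obtain ⟨η, hη, rfl⟩ := h
  funext i
  by_cases hi : i = j
  · subst hi
    simp [depth, (T i).depth_of_adj hη]
  · simp [depth, hi]

theorem chi_eq_image (j : Fin d) (v : ∀ i, V i) :
    chi T j v = Function.update v j '' (T j).children (v j) := by
  ext w
  simp only [chi, Set.mem_image, Set.mem_ofPred_eq, eq_comm]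

theorem finite_chi (hfin : ∀ j, (T j).LocallyFinite) (j : Fin d) (v : ∀ i, V i) :
    (chi T j v).Finite := by
  rw [chi_eq_image]
  exact (hfin j _).image _

theorem ncard_chi_pos (hleaf : ∀ j, (T j).Leafless) (hfin : ∀ j, (T j).LocallyFinite) (j : Fin d)
    (v : ∀ i, V i) : 0 < (chi T j v).ncard := by
  rw [Set.ncard_pos (finite_chi hfin j v), chi_eq_image]
  exact (hleaf j _).image _

theorem chi_par_eq_singleton {j : Fin d} {N : ℕ} (hN : (T j).branchingIndex ≤ N) {v : ∀ i, V i}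
    (hv : N < depth T v j) : chi T j (par T j v) = {v} := by
  rw [chi_eq_image]
  simp only [par, Function.update_self, Function.update_idem]
  rw [(T j).children_parent_eq_singleton hN hv]
  simp

theorem FiniteJointBranchingIndex.exists_bound (hbr : FiniteJointBranchingIndex T) :
    ∃ N : Fin d → ℕ, ∀ j, (T j).branchingIndex ≤ N j :=
  ⟨fun j => ((T j).branchingIndex).toNat, fun j => by rw [ENat.natCast_toNat (hbr j)]⟩

theorem depth_eq_of_mem_sibF {F : Finset (Fin d)} {u v : ∀ i, V i} (hu : u ∈ phi T F)
    (hv : v ∈ sibF T F u) : depth T v = depth T u := by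
  funext j
  by_cases hj : j ∈ F
  · exact ((T j).depth_of_adj (hv.1 j hj)).trans
      ((T j).depth_of_adj ((T j).parent_adj (hu.1 j hj))).symm
  · simp [depth, hv.2 j hj]

section Multishift

variable {lam : Fin d → (∀ i, V i) → ℝ} {j : Fin d}

theorem multishift_apply_of_mem_chi (hb : ∃ C, WeightBound T lam j C) (f : SqSum (∀ i, V i))
    {v w : ∀ i, V i} (hw : w ∈ chi T j v) : multishift T lam j f w = lam j w * f v := by
  rw [multishift, dif_pos hb]
  change shiftFun T lam j f w = _
  rw [shiftFun, if_neg (ne_root_of_mem_chi hw), par_eq_of_mem_chi hw]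

theorem multishift_apply_of_eq_root (hb : ∃ C, WeightBound T lam j C) (f : SqSum (∀ i, V i))
    {w : ∀ i, V i} (hw : w j = (T j).root) : multishift T lam j f w = 0 := by
  rw [multishift, dif_pos hb]
  exact if_pos hw

open Classical in
theorem multishift_single_apply (hb : ∃ C, WeightBound T lam j C) (v w : ∀ i, V i) :
    multishift T lam j (lp.single 2 v (1 : ℂ)) w =
      (chi T j v).indicator (fun w => (lam j w : ℂ)) w := by
  by_cases hroot : w j = (T j).root
  · rw [multishift_apply_of_eq_root hb _ hroot,
      Set.indicator_of_notMem fun hw => ne_root_of_mem_chi hw hroot]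
  · rw [multishift_apply_of_mem_chi hb _ (mem_chi_par T hroot), Set.indicator_apply, mem_chi_iff]
    by_cases hpar : par T j w = v
    · simp [hpar, hroot]
    · simp [hpar]

theorem adjoint_multishift_apply (hb : ∃ C, WeightBound T lam j C) (f : SqSum (∀ i, V i))
    (v : ∀ i, V i) :
    ContinuousLinearMap.adjoint (multishift T lam j) f v =
      ∑' w : chi T j v, (lam j w : ℂ) * f w := by
  classical
  calc ContinuousLinearMap.adjoint (multishift T lam j) f v
      = inner ℂ (multishift T lam j (lp.single 2 v (1 : ℂ))) f := by
        rw [← ContinuousLinearMap.adjoint_inner_right, lp.inner_single_left]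
        simp
    _ = ∑' w, (chi T j v).indicator (fun w => (lam j w : ℂ) * f w) w := by
        rw [lp.inner_eq_tsum]
        refine tsum_congr fun w => ?_
        rw [multishift_single_apply hb]
        by_cases hw : w ∈ chi T j v <;> simp [hw, mul_comm]
    _ = ∑' w : chi T j v, (lam j w : ℂ) * f w := (tsum_subtype _ _).symm

theorem mem_jointCokernel_iff (hb : ∀ j, ∃ C, WeightBound T lam j C) {f : SqSum (∀ i, V i)} :
    f ∈ jointCokernel (multishift T lam) ↔
      ∀ j v, ∑' w : chi T j v, (lam j w : ℂ) * f w = 0 := by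
  simp only [jointCokernel, Submodule.mem_iInf, LinearMap.mem_ker,
    ← adjoint_multishift_apply (hb _)]
  exact forall_congr' fun j => lp.ext_iff.trans funext_iff

end Multishift

variable (T) in
/-- The functions in `l^2(V)` supported on the vertices of depth `β`. -/
def depthPart (β : Fin d → ℕ) : Submodule ℂ (SqSum (∀ i, V i)) where
  carrier := {f | ∀ v, depth T v ≠ β → f v = 0}
  add_mem' hf hg v hv := by simp [hf v hv, hg v hv]
  zero_mem' v _ := rfl
  smul_mem' c f hf v hv := by simp [hf v hv]

theorem isOrtho_depthPart {β γ : Fin d → ℕ} (h : β ≠ γ) : depthPart T β ⟂ depthPart T γ := by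
  rw [Submodule.isOrtho_iff_inner_eq]
  intro f hf g hg
  rw [lp.inner_eq_tsum]
  refine (tsum_congr fun v => ?_).trans tsum_zero
  by_cases hv : depth T v = β
  · rw [hg v (hv.trans_ne h), inner_zero_right]
  · rw [hf v hv, inner_zero_left]

theorem isClosed_depthPart (β : Fin d → ℕ) :
    IsClosed (depthPart T β : Set (SqSum (∀ i, V i))) := by
  have h : (depthPart T β : Set (SqSum (∀ i, V i))) =
      ⋂ v, ⋂ (_ : depth T v ≠ β), {f | f v = 0} := by
    ext f
    simp only [Set.mem_iInter]
    rfl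
  rw [h]
  exact isClosed_iInter fun v => isClosed_iInter fun _ =>
    isClosed_eq (lp.lipschitzWith_one_eval 2 v).continuous continuous_const

end TreeProduct

theorem isClosed_jointCokernel {d : ℕ} {K : Type*} [NormedAddCommGroup K] [InnerProductSpace ℂ K]
    [CompleteSpace K] (S : Fin d → K →L[ℂ] K) : IsClosed (jointCokernel S : Set K) := by
  rw [jointCokernel, Submodule.coe_iInf]
  exact isClosed_iInter fun j => (ContinuousLinearMap.adjoint (S j)).isClosed_ker

namespace TreeProduct

variable {d : ℕ} {V : Fin d → Type*} {T : ∀ j, RootedDirectedTree (V j)}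

variable (T) in
/-- The weights for which the multishift `S` is bounded and `‖S^α e_v‖^2 = W (d_v + α) / W (d_v)`;
this is encoded through `‖S_j e_v‖^2 = ∑_{w ∈ Chi_j(v)} λ_j(w)^2`. -/
structure HasDepthNormSq (lam : Fin d → (∀ i, V i) → ℝ) (W : (Fin d → ℕ) → ℝ) : Prop where
  pos : ∀ β, 0 < W β
  exists_bound : ∀ j, ∃ C, ∀ β, W (β + Pi.single j 1) / W β ≤ C
  hasSum_sq : ∀ j v, HasSum (fun w : chi T j v => lam j w ^ 2)
    (W (depth T v + Pi.single j 1) / W (depth T v))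

variable (T) in
/-- `A` maps the functions supported at depth `β` to functions supported at depth `β + α`, and
scales their squared norms by `W (β + α) / W β`. -/
def IsDepthShift (W : (Fin d → ℕ) → ℝ) (α : Fin d → ℕ)
    (A : SqSum (∀ i, V i) →L[ℂ] SqSum (∀ i, V i)) : Prop :=
  ∀ β, ∀ f ∈ depthPart T β,
    A f ∈ depthPart T (β + α) ∧ ‖A f‖ ^ 2 = W (β + α) / W β * ‖f‖ ^ 2

section IsDepthShift

variable {W : (Fin d → ℕ) → ℝ}

theorem IsDepthShift.one (hW : ∀ β, W β ≠ 0) : IsDepthShift T W 0 1 := fun β f hf => by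
  simpa [hW β] using hf

theorem IsDepthShift.mul (hW : ∀ β, W β ≠ 0) {α α' : Fin d → ℕ}
    {A B : SqSum (∀ i, V i) →L[ℂ] SqSum (∀ i, V i)} (hA : IsDepthShift T W α A)
    (hB : IsDepthShift T W α' B) : IsDepthShift T W (α + α') (A * B) := fun β f hf => by
  obtain ⟨hBmem, hBnorm⟩ := hB β f hf
  obtain ⟨hAmem, hAnorm⟩ := hA _ _ hBmem
  rw [add_comm α, ← add_assoc]
  refine ⟨hAmem, hAnorm.trans ?_⟩
  rw [hBnorm, ← mul_assoc, div_mul_div_cancel₀ (hW _)]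

theorem IsDepthShift.pow (hW : ∀ β, W β ≠ 0) {α : Fin d → ℕ}
    {A : SqSum (∀ i, V i) →L[ℂ] SqSum (∀ i, V i)} (hA : IsDepthShift T W α A) (n : ℕ) :
    IsDepthShift T W (n • α) (A ^ n) := by
  induction n with
  | zero => simpa using IsDepthShift.one hW
  | succ n ih => rw [succ_nsmul, pow_succ]; exact ih.mul hW hA

theorem IsDepthShift.prod_ofFn (hW : ∀ β, W β ≠ 0) {n : ℕ} {α : Fin n → Fin d → ℕ}
    {A : Fin n → SqSum (∀ i, V i) →L[ℂ] SqSum (∀ i, V i)}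
    (hA : ∀ i, IsDepthShift T W (α i) (A i)) :
    IsDepthShift T W (∑ i, α i) (List.ofFn A).prod := by
  induction n with
  | zero => simpa using IsDepthShift.one hW
  | succ n ih =>
    rw [List.ofFn_succ, List.prod_cons, Fin.sum_univ_succ]
    exact (hA 0).mul hW (ih fun i => hA i.succ)

theorem IsDepthShift.tuplePow (hW : ∀ β, W β ≠ 0)
    {S : Fin d → SqSum (∀ i, V i) →L[ℂ] SqSum (∀ i, V i)}
    (hS : ∀ j, IsDepthShift T W (Pi.single j 1) (S j)) (α : Fin d → ℕ) :
    IsDepthShift T W α (tuplePow S α) := by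
  have hα : ∑ j, α j • (Pi.single j 1 : Fin d → ℕ) = α := by
    funext i
    simp [Finset.sum_apply, Pi.single_apply]
  have h := IsDepthShift.prod_ofFn hW fun j => (hS j).pow hW (α j)
  rwa [hα] at h

theorem IsDepthShift.norm_sum_sq {α : Fin d → ℕ}
    {A : SqSum (∀ i, V i) →L[ℂ] SqSum (∀ i, V i)} (hA : IsDepthShift T W α A)
    (s : Finset (Fin d → ℕ)) {f : (Fin d → ℕ) → SqSum (∀ i, V i)}
    (hf : ∀ β, f β ∈ depthPart T β) :
    ‖A (∑ β ∈ s, f β)‖ ^ 2 = ∑ β ∈ s, W (β + α) / W β * ‖f β‖ ^ 2 := by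
  have hortho : OrthogonalFamily ℂ (fun β => depthPart T (β + α))
      fun β => (depthPart T (β + α)).subtypeₗᵢ :=
    OrthogonalFamily.of_pairwise fun β γ h => isOrtho_depthPart ((add_left_injective α).ne h)
  rw [map_sum]
  refine (hortho.norm_sum (fun β => ⟨A (f β), (hA β _ (hf β)).1⟩) s).trans ?_
  exact Finset.sum_congr rfl fun β _ => (hA β _ (hf β)).2

end IsDepthShift

namespace HasDepthNormSq

variable {lam : Fin d → (∀ i, V i) → ℝ} {W : (Fin d → ℕ) → ℝ}

theorem exists_weightBound (h : HasDepthNormSq T lam W) (j : Fin d) :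
    ∃ C, WeightBound T lam j C := by
  obtain ⟨C, hC⟩ := h.exists_bound j
  refine ⟨C, (div_pos (h.pos _) (h.pos 0)).le.trans (hC 0), fun v s hs => ?_⟩
  calc ∑ w ∈ s, lam j w ^ 2
      = ∑ w ∈ s, (chi T j v).indicator (fun w => lam j w ^ 2) w :=
        Finset.sum_congr rfl fun w hw => (Set.indicator_of_mem (hs hw) fun w => lam j w ^ 2).symm
    _ ≤ W (depth T v + Pi.single j 1) / W (depth T v) :=
        sum_le_hasSum s (fun w _ => Set.indicator_nonneg (fun _ _ => sq_nonneg _) w)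
          (hasSum_subtype_iff_indicator.1 (h.hasSum_sq j v))
    _ ≤ C := hC _

theorem adjoint_multishift_multishift (h : HasDepthNormSq T lam W) (j : Fin d) {β : Fin d → ℕ}
    {f : SqSum (∀ i, V i)} (hf : f ∈ depthPart T β) :
    ContinuousLinearMap.adjoint (multishift T lam j) (multishift T lam j f) =
      ((W (β + Pi.single j 1) / W β : ℝ) : ℂ) • f := by
  ext v
  have hterm : ∀ w : chi T j v,
      (lam j w : ℂ) * multishift T lam j f w = ((lam j w ^ 2 : ℝ) : ℂ) * f v := fun w => by
    rw [multishift_apply_of_mem_chi (h.exists_weightBound j) f w.2]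
    push_cast
    ring
  simp only [adjoint_multishift_apply (h.exists_weightBound j), hterm]
  rw [((Complex.hasSum_ofReal.2 (h.hasSum_sq j v)).mul_right (f v)).tsum_eq]
  by_cases hv : depth T v = β
  · rw [hv]; rfl
  · simp [hf v hv]

theorem isDepthShift_multishift (h : HasDepthNormSq T lam W) (j : Fin d) :
    IsDepthShift T W (Pi.single j 1) (multishift T lam j) := by
  refine fun β f hf => ⟨fun w hw => ?_, ?_⟩
  · by_cases hroot : w j = (T j).root
    · exact multishift_apply_of_eq_root (h.exists_weightBound j) f hroot
    · have hmem := mem_chi_par T hroot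
      rw [multishift_apply_of_mem_chi (h.exists_weightBound j) f hmem, hf, mul_zero]
      exact fun hpar => hw ((depth_of_mem_chi hmem).trans (by rw [hpar]))
  · have hinner : inner ℂ (multishift T lam j f) (multishift T lam j f) =
        ((W (β + Pi.single j 1) / W β : ℝ) : ℂ) * inner ℂ f f := by
      rw [← ContinuousLinearMap.adjoint_inner_right, h.adjoint_multishift_multishift j hf,
        inner_smul_right]
    rw [inner_self_eq_norm_sq_to_K, inner_self_eq_norm_sq_to_K] at hinner
    refine Complex.ofReal_injective ?_
    push_cast at hinner ⊢
    exact hinner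

open Classical in
theorem norm_multishift_single_sq (h : HasDepthNormSq T lam W) (j : Fin d) (v : ∀ i, V i) :
    ‖multishift T lam j (lp.single 2 v (1 : ℂ))‖ ^ 2 =
      W (depth T v + Pi.single j 1) / W (depth T v) := by
  have hmem : (lp.single 2 v (1 : ℂ) : SqSum (∀ i, V i)) ∈ depthPart T (depth T v) :=
    fun w hw => lp.single_apply_ne _ _ _ fun hwv => hw (by rw [hwv])
  rw [(h.isDepthShift_multishift j _ _ hmem).2, lp.norm_single (by norm_num)]
  simp

theorem eq_zero_of_not_depth_le (h : HasDepthNormSq T lam W) {N : Fin d → ℕ}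
    (hN : ∀ j, (T j).branchingIndex ≤ N j) {f : SqSum (∀ i, V i)}
    (hf : f ∈ jointCokernel (multishift T lam)) {v : ∀ i, V i} (hv : ¬ depth T v ≤ N) :
    f v = 0 := by
  obtain ⟨j, hj⟩ := not_forall.1 hv
  have hchi := chi_par_eq_singleton (hN j) (not_le.1 hj)
  have hsq := (h.hasSum_sq j (par T j v)).tsum_eq
  have hker := (mem_jointCokernel_iff h.exists_weightBound).1 hf j (par T j v)
  rw [hchi, tsum_singleton v fun w => lam j w ^ 2] at hsq
  rw [hchi, tsum_singleton v fun w => (lam j w : ℂ) * f w] at hker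
  have hlam : lam j v ≠ 0 := fun h0 => by
    rw [h0, zero_pow two_ne_zero] at hsq
    exact (div_pos (h.pos _) (h.pos _)).ne hsq
  simpa [hlam] using hker

end HasDepthNormSq

end TreeProduct

namespace TreeProduct

variable {d : ℕ} {V : Fin d → Type*} {T : ∀ j, RootedDirectedTree (V j)}
  {lam : Fin d → (∀ i, V i) → ℝ}

variable (T lam) in
/-- The elements of the joint cokernel `E` of the multishift that are supported at depth `β`. -/
noncomputable def cokernelPart (β : Fin d → ℕ) : Submodule ℂ (jointCokernel (multishift T lam)) :=
  (depthPart T β).comap (jointCokernel (multishift T lam)).subtype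

instance completeSpace_jointCokernel : CompleteSpace (jointCokernel (multishift T lam)) :=
  (isClosed_jointCokernel _).completeSpace_coe

instance completeSpace_cokernelPart (β : Fin d → ℕ) : CompleteSpace (cokernelPart T lam β) :=
  ((isClosed_depthPart β).preimage continuous_subtype_val).completeSpace_coe

theorem isOrtho_cokernelPart {β γ : Fin d → ℕ} (h : β ≠ γ) :
    cokernelPart T lam β ⟂ cokernelPart T lam γ :=
  Submodule.isOrtho_iff_inner_eq.2 fun f hf g hg => by
    rw [Submodule.coe_inner]
    exact Submodule.isOrtho_iff_inner_eq.1 (isOrtho_depthPart h) _ hf _ hg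

theorem starProjection_cokernelPart_eq_zero {β γ : Fin d → ℕ} (h : γ ≠ β)
    {f : jointCokernel (multishift T lam)} (hf : f ∈ cokernelPart T lam β) :
    (cokernelPart T lam γ).starProjection f = 0 := by
  rw [Submodule.starProjection_apply, Submodule.orthogonalProjectionOnto_apply_of_mem_orthogonal
    (isOrtho_cokernelPart h.symm hf), Submodule.coe_zero]

/-- The children of a vertex have the same depth, so the equations that define the joint cokernel
only involve vertices of one depth. -/
theorem exists_mem_cokernelPart_eq (hb : ∀ j, ∃ C, WeightBound T lam j C)
    (f : jointCokernel (multishift T lam)) (β : Fin d → ℕ) :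
    ∃ g ∈ cokernelPart T lam β, ∀ v, depth T v = β → (g : SqSum (∀ i, V i)) v =
      (f : SqSum (∀ i, V i)) v := by
  classical
  let g : SqSum (∀ i, V i) := ⟨fun v => if depth T v = β then (f : SqSum (∀ i, V i)) v else 0,
    (lp.memℓp (f : SqSum (∀ i, V i))).mono' fun v => by split_ifs <;> simp⟩
  have hg : g ∈ jointCokernel (multishift T lam) := by
    refine (mem_jointCokernel_iff hb).2 fun j v => ?_
    by_cases hv : depth T v + Pi.single j 1 = β
    · rw [← (mem_jointCokernel_iff hb).1 f.2 j v]
      exact tsum_congr fun w => by rw [show g w = _ from if_pos ((depth_of_mem_chi w.2).trans hv)]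
    · refine (tsum_congr fun w => ?_).trans tsum_zero
      rw [show g w = _ from if_neg fun hw => hv ((depth_of_mem_chi w.2).symm.trans hw), mul_zero]
  exact ⟨⟨g, hg⟩, fun v hv => if_neg hv, fun v hv => if_pos hv⟩

namespace HasDepthNormSq

variable {W : (Fin d → ℕ) → ℝ} {N : Fin d → ℕ}

theorem sum_starProjection_cokernelPart (h : HasDepthNormSq T lam W)
    (hN : ∀ j, (T j).branchingIndex ≤ N j) (f : jointCokernel (multishift T lam)) :
    ∑ β ∈ Finset.Iic N, (cokernelPart T lam β).starProjection f = f := by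
  choose g hgmem hg using exists_mem_cokernelPart_eq h.exists_weightBound f
  have hsum : ∑ β ∈ Finset.Iic N, g β = f := by
    ext v
    rw [Submodule.coe_sum, lp.coeFn_sum, Finset.sum_apply]
    have hzero : ∀ β ∈ Finset.Iic N, β ≠ depth T v → (g β : SqSum (∀ i, V i)) v = 0 :=
      fun β _ hβ => hgmem β v hβ.symm
    by_cases hv : depth T v ≤ N
    · rw [Finset.sum_eq_single_of_mem _ (Finset.mem_Iic.2 hv) hzero, hg _ v rfl]
    · rw [h.eq_zero_of_not_depth_le hN f.2 hv]
      exact Finset.sum_eq_zero fun β hβ =>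
        hzero β hβ fun hβv => hv (hβv ▸ Finset.mem_Iic.1 hβ)
  conv_rhs => rw [← hsum]
  refine Finset.sum_congr rfl fun β hβ => ?_
  rw [← hsum, map_sum, Finset.sum_eq_single_of_mem β hβ fun γ _ hγ =>
    starProjection_cokernelPart_eq_zero hγ.symm (hgmem γ)]
  exact Submodule.starProjection_eq_self_iff.2 (hgmem β)

theorem norm_tuplePow_sq (h : HasDepthNormSq T lam W) (hN : ∀ j, (T j).branchingIndex ≤ N j)
    (α : Fin d → ℕ) (f : jointCokernel (multishift T lam)) :
    ‖tuplePow (multishift T lam) α (f : SqSum (∀ i, V i))‖ ^ 2 =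
      ∑ β ∈ Finset.Iic N, W (β + α) / W β * ‖(cokernelPart T lam β).starProjection f‖ ^ 2 := by
  have hshift := IsDepthShift.tuplePow (fun β => (h.pos β).ne') h.isDepthShift_multishift α
  conv_lhs => rw [← h.sum_starProjection_cokernelPart hN f, Submodule.coe_sum]
  exact hshift.norm_sum_sq _ fun β => (cokernelPart T lam β).starProjection_apply_mem f

end HasDepthNormSq

end TreeProduct

theorem AnalyticModel.coeff_monomial {d : ℕ} {K : Type*} [NormedAddCommGroup K]
    [InnerProductSpace ℂ K] [CompleteSpace K] {S : Fin d → K →L[ℂ] K} (α : Fin d → ℕ)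
    (f : jointCokernel S) : (AnalyticModel.monomial α f).coeff = Pi.single α f := by
  refine AnalyticModel.coeff_eq ⟨fun z => ?_, summable_of_ne_finset_zero (s := {α}) fun β hβ => ?_⟩
  · have h := hasSum_single
      (f := fun β => zpowMulti z.1 β • (Pi.single α f : _ → jointCokernel S) β)
      α fun β hβ => by simp [hβ]
    rw [Pi.single_eq_same] at h
    exact h
  · have hβα : β ≠ α := by simpa using hβ
    simp [hβα]

theorem AnalyticModel.norm_monomial_sq {d : ℕ} {K : Type*} [NormedAddCommGroup K]
    [InnerProductSpace ℂ K] [CompleteSpace K] {S : Fin d → K →L[ℂ] K} (α : Fin d → ℕ)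
    (f : jointCokernel S) :
    ‖AnalyticModel.monomial α f‖ ^ 2 = ‖tuplePow S α (f : K)‖ ^ 2 := by
  have h : inner ℂ (AnalyticModel.monomial α f) (AnalyticModel.monomial α f) =
      ∑' β, inner ℂ (tuplePow S β ((AnalyticModel.monomial α f).coeff β : K))
        (tuplePow S β ((AnalyticModel.monomial α f).coeff β : K)) := rfl
  rw [AnalyticModel.coeff_monomial, tsum_eq_single α fun β hβ => by simp [hβ], Pi.single_eq_same,
    inner_self_eq_norm_sq_to_K, inner_self_eq_norm_sq_to_K] at h
  exact_mod_cast h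

section SumSMulMeasure

variable {X ι H : Type*} [MeasurableSpace X] [NormedAddCommGroup H] [InnerProductSpace ℂ H]
  (s : Finset ι) (m : ι → Measure X) [∀ i, IsFiniteMeasure (m i)] (P : ι → H →L[ℂ] H)

/-- The operator-valued measure `A ↦ ∑_{i ∈ s} m_i(A) P_i`. -/
noncomputable def sumSMulMeasure : VectorMeasure X (H →L[ℂ] H) :=
  ∑ i ∈ s, (m i).toSignedMeasure.mapRange
    (((ContinuousLinearMap.toSpanSingleton ℝ (P i)).toLinearMap).toAddMonoidHom)
    (ContinuousLinearMap.toSpanSingleton ℝ (P i)).continuous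

variable {A : Set X}

theorem sumSMulMeasure_apply (hA : MeasurableSet A) :
    sumSMulMeasure s m P A = ∑ i ∈ s, ((m i).real A : ℂ) • P i := by
  simp [sumSMulMeasure, Measure.toSignedMeasure_apply_measurable hA]

theorem sumSMulMeasure_eq_zero (hA : MeasurableSet A) (h : ∀ i ∈ s, m i A = 0) :
    sumSMulMeasure s m P A = 0 := by
  rw [sumSMulMeasure_apply s m P hA]
  exact Finset.sum_eq_zero fun i hi => by simp [Measure.real, h i hi]

theorem isPositive_sumSMulMeasure (hP : ∀ i, (P i).IsPositive) (A : Set X) :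
    (sumSMulMeasure s m P A).IsPositive := by
  by_cases hA : MeasurableSet A
  · rw [sumSMulMeasure_apply s m P hA]
    exact ContinuousLinearMap.isPositive_sum _ fun i _ =>
      (hP i).smul_of_nonneg (Complex.zero_le_real.2 measureReal_nonneg)
  · rw [VectorMeasure.not_measurable _ hA]
    exact ContinuousLinearMap.isPositive_zero

theorem scalarMeasure_sumSMulMeasure (f : H) :
    scalarMeasure (sumSMulMeasure s m P) f =
      ∑ i ∈ s, (inner ℂ f (P i f)).re • (m i).toSignedMeasure := by
  ext A hA
  simp [scalarMeasure, sumSMulMeasure_apply s m P hA,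
    Measure.toSignedMeasure_apply_measurable hA, mul_comm]

variable {m} {g : X → ℝ}

theorem integrable_smul_toSignedMeasure {i : ι} (c : ℝ) (hg : Integrable g (m i)) :
    (c • (m i).toSignedMeasure : SignedMeasure X).Integrable g :=
  VectorMeasure.Integrable.smul_vectorMeasure (by simpa [VectorMeasure.Integrable] using hg) _

theorem integrable_scalarMeasure_sumSMulMeasure (f : H) (hg : ∀ i ∈ s, Integrable g (m i)) :
    (scalarMeasure (sumSMulMeasure s m P) f).Integrable g := by
  rw [scalarMeasure_sumSMulMeasure]
  exact VectorMeasure.Integrable.finsetSum_vectorMeasure fun i hi =>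
    integrable_smul_toSignedMeasure _ (hg i hi)

theorem integral_scalarMeasure_sumSMulMeasure (f : H) (hg : ∀ i ∈ s, Integrable g (m i)) :
    ∫ᵛ x, g x ∂•(scalarMeasure (sumSMulMeasure s m P) f) =
      ∑ i ∈ s, (inner ℂ f (P i f)).re * ∫ x, g x ∂(m i) := by
  rw [scalarMeasure_sumSMulMeasure, VectorMeasure.integral_finsetSum_vectorMeasure fun i hi =>
    integrable_smul_toSignedMeasure _ (hg i hi)]
  refine Finset.sum_congr rfl fun i _ => ?_
  have hflip : ContinuousLinearMap.lsmul ℝ ℝ (E := ℝ) = (ContinuousLinearMap.lsmul ℝ ℝ).flip := by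
    ext
    simp
  rw [VectorMeasure.integral_smul_vectorMeasure, smul_eq_mul, hflip,
    VectorMeasure.integral_toSignedMeasure]

end SumSMulMeasure

namespace TreeProduct

variable {d : ℕ} {V : Fin d → Type*} {T : ∀ j, RootedDirectedTree (V j)}
  {lam : Fin d → (∀ i, V i) → ℝ} {W : (Fin d → ℕ) → ℝ} {N : Fin d → ℕ}

theorem mem_cokernelPart_of_mem_solutionSpace {F : Finset (Fin d)} {u : ∀ i, V i}
    (hu : u ∈ phi T F) {f : jointCokernel (multishift T lam)}
    (hf : (f : SqSum (∀ i, V i)) ∈ solutionSpace T lam F u) :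
    f ∈ cokernelPart T lam (depth T u) :=
  fun v hv => hf.1 v fun hmem => hv (depth_eq_of_mem_sibF hu hmem)

theorem HasDepthNormSq.sumSMulMeasure_apply_of_mem (h : HasDepthNormSq T lam W)
    (hN : ∀ j, (T j).branchingIndex ≤ N j) {X : Type*} [MeasurableSpace X]
    (m : (Fin d → ℕ) → Measure X) [∀ β, IsFiniteMeasure (m β)] {A : Set X} (hA : MeasurableSet A)
    {β : Fin d → ℕ} {f : jointCokernel (multishift T lam)} (hf : f ∈ cokernelPart T lam β) :
    sumSMulMeasure (Finset.Iic N) m (fun β => (cokernelPart T lam β).starProjection) A f =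
      ((m β).real A : ℂ) • f := by
  conv_rhs => rw [← h.sum_starProjection_cokernelPart hN f, Finset.smul_sum]
  rw [sumSMulMeasure_apply _ _ _ hA, sum_apply]
  refine Finset.sum_congr rfl fun γ _ => ?_
  obtain rfl | hγ := eq_or_ne γ β
  · rfl
  · rw [smul_apply, starProjection_cokernelPart_eq_zero hγ hf, smul_zero, smul_zero]

theorem HasDepthNormSq.norm_monomial_sq_eq_integral (h : HasDepthNormSq T lam W)
    (hN : ∀ j, (T j).branchingIndex ≤ N j) {X : Type*} [MeasurableSpace X]
    {m : (Fin d → ℕ) → Measure X} [∀ β, IsFiniteMeasure (m β)] {α : Fin d → ℕ} {g : X → ℝ}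
    (hint : ∀ β, Integrable g (m β)) (hmoment : ∀ β, ∫ x, g x ∂(m β) = W (β + α) / W β)
    (f : jointCokernel (multishift T lam)) :
    ‖AnalyticModel.monomial α f‖ ^ 2 = ∫ᵛ x, g x ∂•(scalarMeasure (sumSMulMeasure (Finset.Iic N) m
      fun β => (cokernelPart T lam β).starProjection) f) := by
  rw [integral_scalarMeasure_sumSMulMeasure _ _ _ fun β _ => hint β,
    AnalyticModel.norm_monomial_sq, h.norm_tuplePow_sq hN]
  refine Finset.sum_congr rfl fun β _ => ?_
  have hre := Submodule.re_inner_starProjection_eq_normSq (cokernelPart T lam β) f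
  rw [hmoment, mul_comm]
  exact congrArg (· * _) (hre.symm.trans (inner_re_symm _ _))

theorem HasDepthNormSq.exists_isRepresentingMeasure (h : HasDepthNormSq T lam W)
    (hbr : FiniteJointBranchingIndex T) {Om : Finset (Fin d) → Set (∀ i, V i)}
    (hOm : ∀ F, Om F ⊆ phi T F) {b : ℝ} (hb : 0 < b) (ρ : (Fin d → ℕ) → Measure ℝ)
    (ν : (Fin d → ℕ) → Measure (CSphere d)) [∀ β, IsFiniteMeasure (ρ β)]
    [∀ β, IsFiniteMeasure (ν β)] [IsProbabilityMeasure (ρ 0)] [IsProbabilityMeasure (ν 0)]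
    (hsupp : ∀ β, ∀ᵐ s ∂(ρ β), s ∈ Set.Icc 0 b)
    (hint : ∀ α β, Integrable (fun p : ℝ × CSphere d => p.1 ^ (∑ i, α i) * ‖zpowMulti p.2.1 α‖ ^ 2)
      ((ρ β).prod (ν β)))
    (hmoment : ∀ α β, ∫ p : ℝ × CSphere d, p.1 ^ (∑ i, α i) * ‖zpowMulti p.2.1 α‖ ^ 2
      ∂((ρ β).prod (ν β)) = W (β + α) / W β) :
    ∃ μ, IsRepresentingMeasure T lam Om b μ (fun u => ρ (depth T u))
      (fun u => ν (depth T u)) := by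
  obtain ⟨N, hN⟩ := hbr.exists_bound
  have hroot : depth T (root T) = 0 := funext fun j => (T j).depth_root
  exact ⟨sumSMulMeasure (Finset.Iic N) (fun β => (ρ β).prod (ν β))
      fun β => (cokernelPart T lam β).starProjection,
    { b_pos := hb
      supported := fun A hA hdisj => by
        refine sumSMulMeasure_eq_zero _ _ _ hA fun β _ => ?_
        have hprod : ∀ᵐ p ∂(ρ β).prod (ν β), p.1 ∈ Set.Icc 0 b :=
          Measure.quasiMeasurePreserving_fst.ae (hsupp β)
        exact measure_mono_null (fun p hp hmem =>
          Set.disjoint_left.1 hdisj hp ⟨hmem, Set.mem_univ _⟩) hprod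
      isPositive := isPositive_sumSMulMeasure _ _ _ fun β =>
        ContinuousLinearMap.IsPositive.of_isStarProjection isStarProjection_starProjection
      finite_rho := fun _ _ _ => inferInstance
      finite_nu := fun _ _ _ => inferInstance
      integral_repr := fun f α =>
        ⟨integrable_scalarMeasure_sumSMulMeasure _ _ f fun β _ => hint α β,
          h.norm_monomial_sq_eq_integral hN (hint α) (hmoment α) f⟩
      diagonal := fun A hA g f hg hsum => by
        have hdiag := fun p : (F : Finset (Fin d)) × Om F => h.sumSMulMeasure_apply_of_mem hN
          (fun β => (ρ β).prod (ν β)) hA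
          (mem_cokernelPart_of_mem_solutionSpace (hOm p.1 p.2.2) (hg p.1 p.2))
        simpa only [hdiag] using hsum.mapL (sumSMulMeasure (Finset.Iic N)
          (fun β => (ρ β).prod (ν β)) (fun β => (cokernelPart T lam β).starProjection) A)
      prob_rho := by rwa [hroot]
      prob_nu := by rwa [hroot] }⟩

end TreeProduct

theorem kernelNormSq_add_single_div {d a : ℕ} (ha : 0 < a) (β : Fin d → ℕ) (j : Fin d) :
    kernelNormSq a (β + Pi.single j 1) / kernelNormSq a β = (β j + 1) / (∑ i, β i + a) := by
  have hprod : ∏ i, (((β + Pi.single j 1 : Fin d → ℕ) i)! : ℝ) = (β j + 1) * ∏ i, ((β i)! : ℝ) := by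
    rw [← Finset.mul_prod_erase _ _ (Finset.mem_univ j),
      ← Finset.mul_prod_erase _ (fun i => ((β i)! : ℝ)) (Finset.mem_univ j), ← mul_assoc]
    congr 1
    · simp [Nat.factorial_succ]
    · exact Finset.prod_congr rfl fun i hi => by simp [Finset.ne_of_mem_erase hi]
  have hsum : ∑ i, (β + Pi.single j 1 : Fin d → ℕ) i + a - 1 = ∑ i, β i + a - 1 + 1 := by
    simp only [Pi.add_apply, Finset.sum_add_distrib, Finset.sum_pi_single', Finset.mem_univ,
      if_true]
    lia
  have hcast : ((∑ i, β i + a - 1 + 1 : ℕ) : ℝ) = ((∑ i, β i : ℕ) : ℝ) + a := by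
    rw [Nat.sub_add_cancel (by lia), Nat.cast_add]
  rw [kernelNormSq, kernelNormSq, hprod, hsum, Nat.factorial_succ, Nat.cast_mul, hcast]
  field_simp

theorem sum_kernelNormSq_add_single_div {d a : ℕ} (ha : 0 < a) (β : Fin d → ℕ) :
    ∑ j, kernelNormSq a (β + Pi.single j 1) / kernelNormSq a β =
      ((∑ i, β i : ℕ) + d) / ((∑ i, β i : ℕ) + a) := by
  simp only [kernelNormSq_add_single_div ha, ← Finset.sum_div, Finset.sum_add_distrib,
    Finset.sum_const, Finset.card_univ, Fintype.card_fin, nsmul_eq_mul, mul_one, Nat.cast_sum]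

theorem dualNormSq_add_single_div {d a : ℕ} (ha : 0 < a) (β : Fin d → ℕ) (j : Fin d) :
    dualNormSq a (β + Pi.single j 1) / dualNormSq a β =
      (β j + 1) * (∑ i, β i + a) / (∑ i, β i + d) ^ 2 := by
  have hd : 0 < d := j.pos
  calc dualNormSq a (β + Pi.single j 1) / dualNormSq a β
      = (kernelNormSq d (β + Pi.single j 1) / kernelNormSq d β) ^ 2 /
          (kernelNormSq a (β + Pi.single j 1) / kernelNormSq a β) := by
        simp only [dualNormSq, div_pow, div_div_div_comm]
    _ = _ := by
        rw [kernelNormSq_add_single_div hd, kernelNormSq_add_single_div ha]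
        field_simp

namespace TreeProduct

variable {d : ℕ} {V : Fin d → Type*} {T : ∀ j, RootedDirectedTree (V j)}

theorem HasDepthNormSq.cauchyDual {lam : Fin d → (∀ i, V i) → ℝ} {W W' : (Fin d → ℕ) → ℝ}
    (h : HasDepthNormSq T lam W) (hpos : ∀ β, 0 < W' β)
    (hbound : ∀ j, ∃ C, ∀ β, W' (β + Pi.single j 1) / W' β ≤ C)
    (hW' : ∀ j β, W' (β + Pi.single j 1) / W' β =
      W (β + Pi.single j 1) / W β / (∑ i, W (β + Pi.single i 1) / W β) ^ 2) :
    HasDepthNormSq T (cauchyDualWeight T lam) W' where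
  pos := hpos
  exists_bound := hbound
  hasSum_sq j v := by
    have hdual : ∀ w : chi T j v, cauchyDualWeight T lam j w ^ 2 = lam j w ^ 2 /
        (∑ i, W (depth T v + Pi.single i 1) / W (depth T v)) ^ 2 := fun w => by
      simp only [cauchyDualWeight, par_eq_of_mem_chi w.2, h.norm_multishift_single_sq]
      rw [mul_pow, inv_pow, div_eq_mul_inv]
    simpa only [hdual, hW'] using (h.hasSum_sq j v).div_const _

theorem druryArvesonWeight_sq {a : ℕ} (ha : 0 < a) {j : Fin d} {v w : ∀ i, V i}
    (hw : w ∈ chi T j v) :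
    druryArvesonWeight T a j w ^ 2 =
      kernelNormSq a (depth T v + Pi.single j 1) / kernelNormSq a (depth T v) /
        (chi T j v).ncard := by
  have hd : 0 < d := j.pos
  rw [druryArvesonWeight, balancedWeight, par_eq_of_mem_chi hw, mul_pow,
    Real.sq_sqrt (by positivity), Real.sq_sqrt (by positivity), kernelNormSq_add_single_div ha]
  simp only [level]
  field_simp

theorem hasDepthNormSq_druryArvesonWeight (hleaf : ∀ j, (T j).Leafless)
    (hfin : ∀ j, (T j).LocallyFinite) {a : ℕ} (ha : 0 < a) :
    HasDepthNormSq T (druryArvesonWeight T a) (kernelNormSq a) where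
  pos := kernelNormSq_pos a
  exists_bound j := ⟨1, fun β => by
    have hle : (β j : ℝ) ≤ ((∑ i, β i : ℕ) : ℝ) :=
      Nat.cast_le.2 (Finset.single_le_sum_of_canonicallyOrdered (Finset.mem_univ j))
    have ha' : (1 : ℝ) ≤ a := by exact_mod_cast ha
    rw [kernelNormSq_add_single_div ha, div_le_one (by positivity)]
    exact add_le_add hle ha'⟩
  hasSum_sq j v := by
    have : Fintype (chi T j v) := (finite_chi hfin j v).fintype
    have hcard : ((chi T j v).ncard : ℝ) ≠ 0 := by
      exact_mod_cast (ncard_chi_pos hleaf hfin j v).ne'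
    convert hasSum_fintype fun w : chi T j v => druryArvesonWeight T a j w ^ 2
    simp only [druryArvesonWeight_sq ha (Subtype.prop _), Finset.sum_const, Finset.card_univ,
      ← Nat.card_eq_fintype_card, Nat.card_coe_set_eq, nsmul_eq_mul, mul_div_cancel₀ _ hcard]

theorem hasDepthNormSq_cauchyDualWeight_druryArvesonWeight (hleaf : ∀ j, (T j).Leafless)
    (hfin : ∀ j, (T j).LocallyFinite) {a : ℕ} (ha : 0 < a) :
    HasDepthNormSq T (cauchyDualWeight T (druryArvesonWeight T a)) (dualNormSq a) := by
  refine (hasDepthNormSq_druryArvesonWeight hleaf hfin ha).cauchyDual (dualNormSq_pos a)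
    (fun j => ⟨a, fun β => ?_⟩) fun j β => ?_
  · have hle : (β j : ℝ) ≤ ((∑ i, β i : ℕ) : ℝ) :=
      Nat.cast_le.2 (Finset.single_le_sum_of_canonicallyOrdered (Finset.mem_univ j))
    have hd : (1 : ℝ) ≤ d := by exact_mod_cast j.pos
    have ha' : (1 : ℝ) ≤ a := by exact_mod_cast ha
    rw [dualNormSq_add_single_div ha, div_le_iff₀ (by positivity)]
    calc ((β j : ℝ) + 1) * ((∑ i, β i : ℕ) + a)
        ≤ ((∑ i, β i : ℕ) + d) * (a * ((∑ i, β i : ℕ) + d)) := by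
          gcongr
          nlinarith [(Nat.cast_nonneg (β j)).trans hle]
      _ = a * ((∑ i, β i : ℕ) + d) ^ 2 := by ring
  · rw [dualNormSq_add_single_div ha, kernelNormSq_add_single_div ha,
      sum_kernelNormSq_add_single_div ha]
    field_simp

end TreeProduct

theorem corollary2p11_general {d : ℕ} {V : Fin d → Type*} (T : ∀ j, RootedDirectedTree (V j))
    (hleaf : ∀ j, (T j).Leafless) (hfin : ∀ j, (T j).LocallyFinite)
    (hbr : TreeProduct.FiniteJointBranchingIndex T)
    (Om : Finset (Fin d) → Set (∀ i, V i)) (hOm : ∀ F, Om F ⊆ TreeProduct.phi T F)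
    (a : ℕ) (ha : 0 < a) (had : a < d) :
    (∀ (l : ℕ), ∀ s ∈ Set.Icc (0 : ℝ) 1, 0 ≤ omegaWeight a d l s) ∧
    ∃ μ, IsRepresentingMeasure T
      (TreeProduct.cauchyDualWeight T (TreeProduct.druryArvesonWeight T a)) Om 1 μ
      (fun u => radialMeasure a d (TreeProduct.level T u))
      (fun u => sphericalMeasure d (TreeProduct.depth T u)) := by
  have hd : 0 < d := ha.trans had
  have := isProbabilityMeasure_radialMeasure ha had
  have := isProbabilityMeasure_sphericalMeasure hd
  exact ⟨fun l s hs => omegaWeight_nonneg ha had l hs,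
    (TreeProduct.hasDepthNormSq_cauchyDualWeight_druryArvesonWeight hleaf hfin
      ha).exists_isRepresentingMeasure hbr hOm one_pos (fun β => radialMeasure a d (∑ i, β i))
      (sphericalMeasure d) (fun β => ae_mem_Icc_radialMeasure a d _)
      (fun α β => integrable_radialMeasure_prod_sphericalMeasure a _ α β)
      (integral_radialMeasure_prod_sphericalMeasure ha had)⟩

theorem corollary2p11 {d : ℕ} {V : Fin d → Type*} (T : ∀ j, RootedDirectedTree (V j))
    (hleaf : ∀ j, (T j).Leafless) (hfin : ∀ j, (T j).LocallyFinite)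
    (hbr : TreeProduct.FiniteJointBranchingIndex T)
    (Om : Finset (Fin d) → Set (∀ i, V i)) (hOm : ∀ F, TreeProduct.IsIndexingSet T F (Om F))
    (a : ℕ) (ha : 0 < a) (had : a < d) :
    (∀ (l : ℕ), ∀ s ∈ Set.Icc (0 : ℝ) 1, 0 ≤ omegaWeight a d l s) ∧
    ∃ μ, IsRepresentingMeasure T
      (TreeProduct.cauchyDualWeight T (TreeProduct.druryArvesonWeight T a)) Om 1 μ
      (fun u => radialMeasure a d (TreeProduct.level T u))
      (fun u => sphericalMeasure d (TreeProduct.depth T u)) :=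
  corollary2p11_general T hleaf hfin hbr Om (fun F => (hOm F).1) a ha had
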